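/- Let $\mathbb D$ be the open unit disk in $\mathbb C$, let $dA$ be Lebesgue measure on $\mathbb D$ normalized so that $A(\mathbb D)=1$, and write $|E|=A(E)$. Let $\alpha>-1$ and $\omega_\alpha(z)=(1+\alpha)(1-|z|^2)^\alpha$. Let $L^2_a(\omega_\alpha)$ be the weighted Bergman space of analytic functions on $\mathbb D$ in $L^2(\omega_\alpha)=L^2(\mathbb D,\omega_\alpha\,dA)$, let $P$ be the orthogonal projection of $L^2(\omega_\alpha)$ onto $L^2_a(\omega_\alpha)$, and let $K^\alpha_z(\lambda)=(1-\bar z\lambda)^{-(2+\alpha)}$ be its reproducing kernel. For bounded measurable $\varphi$ let $\mathbb T_\varphi f=P(\varphi f)$ be the Toeplitz operator on $L^2_a(\omega_\alpha)$. Let $0\le\varphi\in L^\infty(\omega_\alpha)$ (where $\varphi\ge 0$ almost everywhere), and for $r>0$ put $G_r=\{z\in\mathbb D:\varphi(z)>r\}$. The following are equivalent: (1) $\mathbb T_\varphi$ is invertible on $L^2_a(\omega_\alpha)$; (2) the Berezin transform $$\widehat\varphi(z)=\frac{1}{\|K^\alpha_z\|^2_{L^2(\omega_\alpha)}}\int_{\mathbb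 D}\varphi(\lambda)\,|K^\alpha_z(\lambda)|^2\,\omega_\alpha(\lambda)\,dA(\lambda)$$ is invertible in $L^\infty(\omega_\alpha)$; (3) there is $r>0$ such that, with $G=G_r$, $\chi_G\,dA$ is a reverse Carleson measure for $L^2_a(\omega_\alpha)$, i.e. there is $C>0$ with $$\int_{\mathbb D}|f|^2\omega_\alpha\,dA\le C\int_{G}|f|^2\omega_\alpha\,dA\qquad\text{for all } f\in L^2_a(\omega_\alpha);$$ (4) there is $r>0$ such that $G=G_r$ satisfies, for some $\delta\in(0,1)$, $$|G\cap K|\ge\delta\,|\mathbb D\cap K|$$ for every Euclidean ball $K$ whose center lies on $\partial\mathbb D$; (5) there is $C>0$ such that $$\int_{\mathbb D}|f|^2\varphi\,\omega_\alpha\,dA\ge C\int_{\mathbb D}|f|^2\omega_\alpha\,dA\qquad\text{for all } f\in L^2_a(\omega_\alpha).$$ Moreover the set $G$ in (3) and (4) can be taken to be the same: for each fixed $r>0$, $\chi_{G_r}\,dA$ is a reverse Carleson measure for $L^2_a(\omega_\alpha)$ if and only if $G_r$ satisfies the density condition in (4) for some $\delta\in(0,1)$. -/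

import Mathlib

open scoped ENNReal

namespace DiskBergman

open MeasureTheory Filter Topology

/-- Normalized Lebesgue measure `dA` on the open unit disk, `dA(𝔻) = 1`
(as a measure on `ℂ` carried by the disk). -/
noncomputable def diskArea : Measure ℂ :=
  (ENNReal.ofReal Real.pi)⁻¹ • volume.restrict (Metric.ball (0 : ℂ) 1)

/-- The standard weight `ω_α(z) = (1 + α) (1 - |z|²)^α`. -/
noncomputable def weight (α : ℝ) (z : ℂ) : ℝ := (1 + α) * (1 - ‖z‖ ^ 2) ^ α

/-- The measure `ω_α dA`. -/
noncomputable def weightedArea (α : ℝ) : Measure ℂ :=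
  diskArea.withDensity fun z => ENNReal.ofReal (weight α z)

/-- The weighted analytic Bergman space `L²_a(ω_α)`: the classes in `L²(ω_α dA)` that have a
representative analytic on the open unit disk. -/
noncomputable def bergmanSpace (α : ℝ) : Submodule ℂ (Lp ℂ 2 (weightedArea α)) where
  carrier := {f | ∃ g : ℂ → ℂ, DifferentiableOn ℂ g (Metric.ball 0 1) ∧
    (f : ℂ → ℂ) =ᵐ[weightedArea α] g}
  add_mem' := by
    rintro f₁ f₂ ⟨g₁, hg₁, h₁⟩ ⟨g₂, hg₂, h₂⟩
    refine ⟨g₁ + g₂, hg₁.add hg₂, ?_⟩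
    filter_upwards [Lp.coeFn_add f₁ f₂, h₁, h₂] with z hz hz₁ hz₂
    rw [hz, Pi.add_apply, Pi.add_apply, hz₁, hz₂]
  zero_mem' := ⟨0, differentiableOn_const 0, Lp.coeFn_zero ℂ 2 (weightedArea α)⟩
  smul_mem' := by
    rintro c f ⟨g, hg, h⟩
    refine ⟨c • g, hg.const_smul c, ?_⟩
    filter_upwards [Lp.coeFn_smul c f, h] with z hz hz'
    simp [hz, hz']

section Closed

/-! Completeness of the Bergman space, needed for the orthogonal projection onto it. -/

theorem circle_bound {g : ℂ → ℂ} {a : ℂ} {R ρ : ℝ} (hg : DifferentiableOn ℂ g (Metric.ball a R))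
    (hρ : 0 < ρ) (hρR : ρ < R) :
    ENNReal.ofReal (2 * Real.pi) * ‖g a‖ₑ
      ≤ ∫⁻ θ in Set.Ioo (-Real.pi) Real.pi, ‖g (circleMap a ρ θ)‖ₑ := by
  have hd : DiffContOnCl ℂ g (Metric.ball a |ρ|) := by
    rw [abs_of_pos hρ]
    exact (hg.mono (Metric.closedBall_subset_ball hρR)).diffContOnCl_ball subset_rfl
  have h1 := hd.circleAverage
  have hper : Function.Periodic (fun θ => g (circleMap a ρ θ)) (2 * Real.pi) := fun θ => by
    simp only [periodic_circleMap a ρ θ]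
  have h2 := hper.intervalIntegral_add_eq 0 (-Real.pi)
  have e1 : -Real.pi + 2 * Real.pi = Real.pi := by ring
  rw [zero_add, e1] at h2
  have hpi : (0 : ℝ) < 2 * Real.pi := by positivity
  rw [Real.circleAverage_def, h2, intervalIntegral.integral_of_le (by linarith [Real.pi_pos]),
    integral_Ioc_eq_integral_Ioo] at h1
  have h3 : (2 * Real.pi) • g a = ∫ θ in Set.Ioo (-Real.pi) Real.pi, g (circleMap a ρ θ) := by
    rw [← h1, smul_smul, mul_inv_cancel₀ hpi.ne', one_smul]
  calc ENNReal.ofReal (2 * Real.pi) * ‖g a‖ₑ = ‖(2 * Real.pi) • g a‖ₑ := by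
        rw [enorm_smul, Real.enorm_eq_ofReal hpi.le]
    _ ≤ _ := by rw [h3]; exact enorm_integral_le_lintegral_enorm _

theorem area_bound {R : ℝ} (hR : 0 < R) :
    ∃ c : ℝ≥0∞, c ≠ 0 ∧ c ≠ ∞ ∧ ∀ (g : ℂ → ℂ) (a : ℂ), DifferentiableOn ℂ g (Metric.ball a R) →
      c * ‖g a‖ₑ ≤ ∫⁻ z in Metric.ball a R, ‖g z‖ₑ := by
  refine ⟨ENNReal.ofReal (R / 2) * ENNReal.ofReal (2 * Real.pi) * ENNReal.ofReal (R / 2),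
    ?_, by finiteness, ?_⟩
  · have := Real.pi_pos
    simp only [ne_eq, mul_eq_zero, ENNReal.ofReal_eq_zero, not_or, not_le]
    refine ⟨⟨?_, ?_⟩, ?_⟩ <;> positivity
  intro g a hg
  set F : ℂ → ℝ≥0∞ := (Metric.ball a R).indicator fun z => ‖g z‖ₑ with hF
  have hFm : Measurable F := by
    have : Measurable ((Metric.ball a R).indicator g) := by
      classical
      rw [← Set.piecewise_eq_indicator]
      exact hg.continuousOn.measurable_piecewise continuousOn_const Metric.isOpen_ball.measurableSet
    have h2 : F = fun z => ‖(Metric.ball a R).indicator g z‖ₑ := by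
      ext z
      by_cases hz : z ∈ Metric.ball a R <;> simp [hF, hz]
    rw [h2]; exact this.enorm
  have e1 : ∫⁻ z in Metric.ball a R, ‖g z‖ₑ = ∫⁻ z, F (a + z) := by
    rw [lintegral_add_left_eq_self F a, hF, lintegral_indicator Metric.isOpen_ball.measurableSet]
  have hsymm : ∀ p : ℝ × ℝ, a + Complex.polarCoord.symm p = circleMap a p.1 p.2 := by
    intro p
    simp [Complex.polarCoord_symm_apply, circleMap, Complex.exp_mul_I]
  have hcm : Measurable fun p : ℝ × ℝ => F (circleMap a p.1 p.2) := by
    apply hFm.comp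
    unfold circleMap
    fun_prop
  rw [e1, ← Complex.lintegral_comp_polarCoord_symm, polarCoord_target]
  simp only [hsymm, smul_eq_mul]
  rw [Measure.volume_eq_prod, ← Measure.prod_restrict, lintegral_prod _ (by fun_prop)]
  calc ENNReal.ofReal (R / 2) * ENNReal.ofReal (2 * Real.pi) * ENNReal.ofReal (R / 2) * ‖g a‖ₑ
      = ∫⁻ _ρ in Set.Ioo (R / 2) R,
          ENNReal.ofReal (R / 2) * (ENNReal.ofReal (2 * Real.pi) * ‖g a‖ₑ) := by
        rw [setLIntegral_const, Real.volume_Ioo, show R - R / 2 = R / 2 by ring]; ring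
    _ ≤ ∫⁻ ρ in Set.Ioo (R / 2) R, ∫⁻ θ in Set.Ioo (-Real.pi) Real.pi,
          ENNReal.ofReal ρ * F (circleMap a ρ θ) := by
        refine setLIntegral_mono' measurableSet_Ioo fun ρ hρ => ?_
        have hρ0 : 0 < ρ := by linarith [hρ.1]
        rw [lintegral_const_mul' _ _ ENNReal.ofReal_ne_top]
        refine mul_le_mul' (ENNReal.ofReal_le_ofReal hρ.1.le) ?_
        refine (circle_bound hg hρ0 hρ.2).trans_eq ?_
        refine lintegral_congr fun θ => ?_
        have : circleMap a ρ θ ∈ Metric.ball a R := by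
          have := circleMap_mem_sphere a hρ0.le θ
          rw [mem_sphere_iff_norm] at this
          rw [mem_ball_iff_norm, this]; exact hρ.2
        simp [hF, this]
    _ ≤ _ := lintegral_mono_set fun ρ hρ => by
        simp only [Set.mem_Ioi]; linarith [hρ.1]

theorem volume_le_weightedArea {α : ℝ} (hα : -1 < α) {R : ℝ} (hR : R < 1) :
    ∃ C : ℝ≥0∞, C ≠ ∞ ∧ volume.restrict (Metric.ball (0 : ℂ) R) ≤ C • weightedArea α := by
  rcases le_or_gt R 0 with hR0 | hR0
  · exact ⟨0, ENNReal.zero_ne_top, by simp [Metric.ball_eq_empty.2 hR0]⟩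
  have hR2 : 0 < 1 - R ^ 2 := by nlinarith
  set m : ℝ := (1 + α) * min 1 ((1 - R ^ 2) ^ α) with hm
  have hm0 : 0 < m :=
    mul_pos (by linarith) (lt_min one_pos (Real.rpow_pos_of_pos hR2 α))
  have hw : ∀ z ∈ Metric.ball (0 : ℂ) R, m ≤ weight α z := by
    intro z hz
    rw [mem_ball_zero_iff] at hz
    have h1 : 1 - R ^ 2 ≤ 1 - ‖z‖ ^ 2 := by nlinarith [norm_nonneg z]
    have h2 : 1 - ‖z‖ ^ 2 ≤ 1 := by nlinarith [norm_nonneg z]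
    refine mul_le_mul_of_nonneg_left ?_ (by linarith)
    rcases le_or_gt 0 α with h | h
    · exact (min_le_right _ _).trans (Real.rpow_le_rpow hR2.le h1 h)
    · exact (min_le_left _ _).trans
        (Real.one_le_rpow_of_pos_of_le_one_of_nonpos (hR2.trans_le h1) h2 h.le)
  set c : ℝ≥0∞ := ENNReal.ofReal m * (ENNReal.ofReal Real.pi)⁻¹ with hc
  have hc0 : c ≠ 0 := by
    simp [hc, hm0]
  have hct : c ≠ ∞ :=
    ENNReal.mul_ne_top ENNReal.ofReal_ne_top (by simp [Real.pi_pos])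
  refine ⟨c⁻¹, by simpa using hc0, Measure.le_iff.2 fun s hs => ?_⟩
  have hB : MeasurableSet (Metric.ball (0 : ℂ) R) := Metric.isOpen_ball.measurableSet
  rw [Measure.restrict_apply hs, Measure.smul_apply, smul_eq_mul]
  have key : c * volume (s ∩ Metric.ball (0 : ℂ) R) ≤ weightedArea α s := by
    calc c * volume (s ∩ Metric.ball (0 : ℂ) R)
        = ∫⁻ _z in s ∩ Metric.ball (0 : ℂ) R, ENNReal.ofReal m ∂diskArea := by
          rw [setLIntegral_const, diskArea, Measure.smul_apply,
            Measure.restrict_apply (hs.inter hB), smul_eq_mul, Set.inter_assoc,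
            Set.inter_eq_left.2 (Metric.ball_subset_ball hR.le), hc, mul_assoc]
      _ ≤ ∫⁻ z in s ∩ Metric.ball (0 : ℂ) R, ENNReal.ofReal (weight α z) ∂diskArea :=
          setLIntegral_mono' (hs.inter hB) fun z hz => ENNReal.ofReal_le_ofReal (hw z hz.2)
      _ ≤ ∫⁻ z in s, ENNReal.ofReal (weight α z) ∂diskArea :=
          lintegral_mono_set Set.inter_subset_left
      _ = weightedArea α s := (withDensity_apply _ hs).symm
  calc volume (s ∩ Metric.ball (0 : ℂ) R) = c⁻¹ * (c * volume (s ∩ Metric.ball (0 : ℂ) R)) := by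
        rw [← mul_assoc, ENNReal.inv_mul_cancel hc0 hct, one_mul]
    _ ≤ c⁻¹ * weightedArea α s := by gcongr

theorem eval_bound {α : ℝ} (hα : -1 < α) {R : ℝ} (hR : R < 1) :
    ∃ C : ℝ≥0∞, C ≠ ∞ ∧ ∀ g : ℂ → ℂ, DifferentiableOn ℂ g (Metric.ball 0 1) →
      ∀ a ∈ Metric.ball (0 : ℂ) R, ‖g a‖ₑ ≤ C * eLpNorm g 2 (weightedArea α) := by
  set d : ℝ := (1 - R) / 2 with hd
  have hd0 : 0 < d := by linarith
  obtain ⟨C, hC, hCle⟩ := volume_le_weightedArea hα (R := R + d) (by linarith)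
  obtain ⟨c, hc0, hct, hc⟩ := area_bound hd0
  set V : Measure ℂ := volume.restrict (Metric.ball (0 : ℂ) (R + d)) with hV
  have hVfin : V Set.univ ≠ ∞ := by
    rw [hV, Measure.restrict_apply_univ]; exact measure_ball_lt_top.ne
  set D : ℝ≥0∞ := V Set.univ ^ (1 / (1 : ℝ≥0∞).toReal - 1 / (2 : ℝ≥0∞).toReal) with hD
  have hDt : D ≠ ∞ := by
    refine ENNReal.rpow_ne_top_of_nonneg ?_ hVfin
    norm_num
  refine ⟨c⁻¹ * (C ^ (1 / (2 : ℝ≥0∞).toReal) * D), ?_, fun g hg a ha => ?_⟩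
  · refine ENNReal.mul_ne_top (by simpa using hc0) (ENNReal.mul_ne_top ?_ hDt)
    exact ENNReal.rpow_ne_top_of_nonneg (by norm_num) hC
  have hsub : Metric.ball a d ⊆ Metric.ball (0 : ℂ) (R + d) := by
    refine Metric.ball_subset_ball' ?_
    rw [Metric.mem_ball] at ha; linarith
  have hsub1 : Metric.ball (0 : ℂ) (R + d) ⊆ Metric.ball 0 1 :=
    Metric.ball_subset_ball (by linarith)
  have h1 : c * ‖g a‖ₑ ≤ eLpNorm g 1 V := by
    rw [eLpNorm_one_eq_lintegral_enorm]
    exact (hc g a (hg.mono (hsub.trans hsub1))).trans (lintegral_mono_set hsub)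
  have hgm : AEStronglyMeasurable g V :=
    (hg.continuousOn.mono hsub1).aestronglyMeasurable Metric.isOpen_ball.measurableSet
  have h2 : eLpNorm g 1 V ≤ eLpNorm g 2 V * D :=
    eLpNorm_le_eLpNorm_mul_rpow_measure_univ (by norm_num) hgm
  have h3 : eLpNorm g 2 V ≤ C ^ (1 / (2 : ℝ≥0∞).toReal) * eLpNorm g 2 (weightedArea α) := by
    refine (eLpNorm_mono_measure g hCle).trans_eq ?_
    rw [eLpNorm_smul_measure_of_ne_top (by norm_num)]
    simp
  calc ‖g a‖ₑ = c⁻¹ * (c * ‖g a‖ₑ) := by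
        rw [← mul_assoc, ENNReal.inv_mul_cancel hc0 hct, one_mul]
    _ ≤ c⁻¹ * ((C ^ (1 / (2 : ℝ≥0∞).toReal) * eLpNorm g 2 (weightedArea α)) * D) := by
        exact mul_le_mul_right (h1.trans (h2.trans (mul_le_mul_left h3 D))) c⁻¹
    _ = _ := by ring

theorem isClosed_bergmanSpace (α : ℝ) :
    IsClosed (bergmanSpace α : Set (Lp ℂ 2 (weightedArea α))) := by
  rcases le_or_gt α (-1) with hα | hα
  · have h0 : weightedArea α = 0 := by
      have hz : (fun z => ENNReal.ofReal (weight α z)) =ᵐ[diskArea] 0 := by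
        have hae : ∀ᵐ z ∂diskArea, z ∈ Metric.ball (0 : ℂ) 1 :=
          Measure.ae_smul_measure (ae_restrict_mem Metric.isOpen_ball.measurableSet) _
        filter_upwards [hae] with z hz
        rw [mem_ball_zero_iff] at hz
        refine ENNReal.ofReal_eq_zero.2 (mul_nonpos_of_nonpos_of_nonneg (by linarith) ?_)
        exact Real.rpow_nonneg (by nlinarith [norm_nonneg z]) _
      rw [weightedArea, withDensity_congr_ae hz, withDensity_zero]
    have : (bergmanSpace α : Set (Lp ℂ 2 (weightedArea α))) = Set.univ := by
      refine Set.eq_univ_of_forall fun f => ⟨0, differentiableOn_const 0, ?_⟩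
      have : ae (weightedArea α) = ⊥ := by rw [h0, ae_zero]
      rw [EventuallyEq, this]; trivial
    rw [this]; exact isClosed_univ
  refine IsSeqClosed.isClosed fun f F hf hF => ?_
  choose g hg hfg using hf
  have hunif : ∀ R < 1, UniformCauchySeqOn g atTop (Metric.ball (0 : ℂ) R) := by
    intro R hR
    obtain ⟨C, hC, hCle⟩ := eval_bound hα hR
    rw [Metric.uniformCauchySeqOn_iff]
    intro ε hε
    obtain ⟨N, hN⟩ := Metric.cauchySeq_iff.1 hF.cauchySeq (ε / (C.toReal + 1)) (by positivity)
    refine ⟨N, fun m hm n hn z hz => ?_⟩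
    have h1 := hCle (g m - g n) ((hg m).sub (hg n)) z hz
    have h2 : eLpNorm (g m - g n) 2 (weightedArea α) = ENNReal.ofReal (dist (f m) (f n)) := by
      rw [← edist_dist, Lp.edist_def]
      exact eLpNorm_congr_ae ((hfg m).symm.sub (hfg n).symm)
    rw [h2, Pi.sub_apply, ← edist_eq_enorm_sub, edist_dist, ← ENNReal.ofReal_toReal hC,
      ← ENNReal.ofReal_mul ENNReal.toReal_nonneg,
      ENNReal.ofReal_le_ofReal_iff (by positivity)] at h1
    have h3 := hN m hm n hn
    have hC0 : (0 : ℝ) ≤ C.toReal := ENNReal.toReal_nonneg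
    rw [lt_div_iff₀ (by positivity)] at h3
    nlinarith [dist_nonneg (x := f m) (y := f n)]
  have hex : ∀ z : ℂ, ∃ l : ℂ, z ∈ Metric.ball (0 : ℂ) 1 → Tendsto (fun n => g n z) atTop (𝓝 l) := by
    intro z
    by_cases hz : z ∈ Metric.ball (0 : ℂ) 1
    · obtain ⟨R, hzR, hR⟩ := exists_between (mem_ball_zero_iff.1 hz)
      obtain ⟨l, hl⟩ := cauchySeq_tendsto_of_complete
        ((hunif R hR).cauchySeq (mem_ball_zero_iff.2 hzR))
      exact ⟨l, fun _ => hl⟩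
    · exact ⟨0, fun h => absurd h hz⟩
  choose G hG using hex
  have hloc : TendstoLocallyUniformlyOn g G atTop (Metric.ball (0 : ℂ) 1) := by
    rw [tendstoLocallyUniformlyOn_iff_forall_tendsto]
    intro z hz
    obtain ⟨R, hzR, hR⟩ := exists_between (mem_ball_zero_iff.1 hz)
    have hu : TendstoUniformlyOn g G atTop (Metric.ball (0 : ℂ) R) :=
      (hunif R hR).tendstoUniformlyOn_of_tendsto fun w hw =>
        hG w (Metric.ball_subset_ball hR.le hw)
    rw [tendstoUniformlyOn_iff_tendsto] at hu
    refine hu.mono_left (prod_mono le_rfl ?_)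
    refine nhdsWithin_le_nhds.trans (le_principal_iff.2 ?_)
    exact Metric.isOpen_ball.mem_nhds (mem_ball_zero_iff.2 hzR)
  refine ⟨G, hloc.differentiableOn (Eventually.of_forall hg) Metric.isOpen_ball, ?_⟩
  obtain ⟨ns, hns, hae⟩ := (tendstoInMeasure_of_tendsto_Lp hF).exists_seq_tendsto_ae
  have hball : ∀ᵐ z ∂weightedArea α, z ∈ Metric.ball (0 : ℂ) 1 := by
    refine (withDensity_absolutelyContinuous _ _).ae_le ?_
    exact Measure.ae_smul_measure (ae_restrict_mem Metric.isOpen_ball.measurableSet) _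
  filter_upwards [hae, ae_all_iff.2 hfg, hball] with z h1 h2 h3
  simp only [h2] at h1
  exact tendsto_nhds_unique h1 ((hG z h3).comp hns.tendsto_atTop)

end Closed

instance (α : ℝ) : CompleteSpace (bergmanSpace α) :=
  (isClosed_bergmanSpace α).completeSpace_coe

/-- The Toeplitz operator `f ↦ P (φ f)` on `L²_a(ω_α)` with bounded symbol `φ`, where `P` is the
orthogonal projection of `L²(ω_α)` onto `L²_a(ω_α)`. -/
noncomputable def toeplitz (α : ℝ) (φ : Lp ℂ ∞ (weightedArea α)) :
    bergmanSpace α →L[ℂ] bergmanSpace α :=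
  (bergmanSpace α).orthogonalProjectionOnto ∘L
    ((ContinuousLinearMap.mul ℂ ℂ).holderL (weightedArea α) ∞ 2 2 φ) ∘L (bergmanSpace α).subtypeL

/-- The reproducing kernel `K^α_z(w) = (1 - z̄ w)^{-(2+α)}` of `L²_a(ω_α)` (principal branch). -/
noncomputable def kernel (α : ℝ) (z w : ℂ) : ℂ :=
  1 / (1 - (starRingEnd ℂ) z * w) ^ ((2 + α : ℝ) : ℂ)

/-- The Berezin transform
`φ̂(z) = ‖K^α_z‖⁻² ∫ φ(w) |K^α_z(w)|² ω_α(w) dA(w)`. -/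
noncomputable def berezin (α : ℝ) (φ : ℂ → ℝ) (z : ℂ) : ℝ :=
  1 / (∫ w, ‖kernel α z w‖ ^ 2 ∂weightedArea α) *
    ∫ w, φ w * ‖kernel α z w‖ ^ 2 ∂weightedArea α

/-- `f` is an invertible element of the algebra `L^∞(ω_α)`. -/
def IsInvertibleLInfty (α : ℝ) (f : ℂ → ℝ) : Prop :=
  MemLp f ∞ (weightedArea α) ∧
    ∃ g : ℂ → ℝ, MemLp g ∞ (weightedArea α) ∧ ∀ᵐ z ∂weightedArea α, f z * g z = 1

/-- `χ_G dA` is a reverse Carleson measure for `L²_a(ω_α)`. -/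
def IsReverseCarleson (α : ℝ) (G : Set ℂ) : Prop :=
  ∃ C : ℝ, 0 < C ∧ ∀ f : bergmanSpace α,
    ∫ z, ‖(f : Lp ℂ 2 (weightedArea α)) z‖ ^ 2 ∂weightedArea α
      ≤ C * ∫ z in G, ‖(f : Lp ℂ 2 (weightedArea α)) z‖ ^ 2 ∂weightedArea α

/-- There is `δ ∈ (0,1)` with `|G ∩ K| ≥ δ |𝔻 ∩ K|` for every Euclidean ball `K` centred on the
unit circle. -/
def IsBoundaryDense (G : Set ℂ) : Prop :=
  ∃ δ : ℝ, 0 < δ ∧ δ < 1 ∧ ∀ (ζ : ℂ) (t : ℝ), ‖ζ‖ = 1 → 0 < t →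
    δ * diskArea.real (Metric.ball 0 1 ∩ Metric.ball ζ t)
      ≤ diskArea.real (G ∩ Metric.ball ζ t)

/-- The level set `{z ∈ 𝔻 : φ(z) > r}`. -/
def levelSet (φ : ℂ → ℝ) (r : ℝ) : Set ℂ := {z | z ∈ Metric.ball (0 : ℂ) 1 ∧ r < φ z}

end DiskBergman

/-!
The implications that do not concern analytic functions are soft. The Toeplitz operator `T` with
symbol `φ ≥ 0` satisfies `⟪T f, f⟫ = ∫ φ |f|²` and `‖T f‖² ≤ ‖φ‖_∞ ∫ φ |f|²`, so it is invertible
exactly when its quadratic form is coercive (`isUnit_toeplitz_iff`). A reverse Carleson level set makes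
the form coercive because `φ > r` there, and coercivity tested on the reproducing kernels bounds the
Berezin transform below. If the Berezin transform is bounded below, discarding the part of `φ` below a
small level `r` shows that `G_r` carries a fixed proportion of the mass of almost every kernel. What
remains is the equivalence, for one set `G`, of the reverse Carleson property with density at the
boundary (`isReverseCarleson_iff_isBoundaryDense`).

From kernels to density: let `z` lie at distance about `t / M` from `ζ` on the unit circle. Since
`ω_α(B(ζ, s))` is at most of order `s ^ (2 + α)`, the part of `|K_z|²` outside `B(ζ, t)` is a small
fraction of `‖K_z‖²` once `M` is large, uniformly in `ζ` and `t`. As `|K_z|²` is bounded by a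
multiple of `t ^ (-2 (2 + α))`, the `ω_α`-area of `G ∩ B(ζ, t)` is at least of order `t ^ (2 + α)`
(`exists_le_weightedArea_inter_ball`). A thin strip along the circle has small `ω_α`-area, and off
this strip `ω_α` is of order `t ^ α`, which gives the bound for the unweighted area
(`isBoundaryDense_of_le_weightedArea`).

From density to the reverse Carleson inequality (Luecking's theorem), using only Euclidean discs: the
discs `B(a, 1 - |a|)` and the unit disc are tangent at the boundary point nearest to `a`, so density
in a small disc around that point yields `κ < 1` such that `G` has positive density in every
`B_a = B(a, κ (1 - |a|))` (`IsBoundaryDense.exists_le_volume_inter_ball`). Points `a` at which `|f(a)|²`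
is less than `η` times the mean of `|f|²` over `B_a` carry at most half of the norm of `f` when `η` is
small, because averaging over the `B_a` is bounded on `L¹(ω_α)` (`lintegral_average_le`). At the other
points, Jensen's inequality for `log |f|` shows that `|f| > λ |f(a)|` on most of `B_a`
(`volume_sublevel_le`), in particular on a fixed proportion of `G ∩ B_a`, so `|f(a)|²` is controlled by
the mean of `|f|²` over `G ∩ B_a`. Averaging once more gives the inequality
(`IsBoundaryDense.exists_lintegral_le`).
-/

namespace DiskBergman

open MeasureTheory Filter Topology Real

/-! ### Jensen's inequality on discs -/

/-- Integration in polar coordinates centred at `a`. -/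
theorem lintegral_polar (a : ℂ) {F : ℂ → ℝ≥0∞} (hF : Measurable F) :
    ∫⁻ z, F z = ∫⁻ ρ in Set.Ioi (0 : ℝ), ∫⁻ θ in Set.Ioo (-π) π,
      ENNReal.ofReal ρ * F (circleMap a ρ θ) := by
  have hsymm : ∀ p : ℝ × ℝ, a + Complex.polarCoord.symm p = circleMap a p.1 p.2 := by
    intro p
    simp [Complex.polarCoord_symm_apply, circleMap, Complex.exp_mul_I]
  have hcm : Measurable fun p : ℝ × ℝ => F (circleMap a p.1 p.2) := by
    apply hF.comp
    unfold circleMap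
    fun_prop
  rw [← lintegral_add_left_eq_self F a, ← Complex.lintegral_comp_polarCoord_symm,
    polarCoord_target]
  simp only [hsymm, smul_eq_mul]
  rw [Measure.volume_eq_prod, ← Measure.prod_restrict, lintegral_prod _ (by fun_prop)]

/-- Jensen's inequality: `log ‖g‖` is subharmonic, for `g` analytic with `g a ≠ 0`. -/
theorem log_norm_le_circleAverage {g : ℂ → ℂ} {a : ℂ} {R ρ : ℝ}
    (hg : DifferentiableOn ℂ g (Metric.ball a R)) (hρ : 0 < ρ) (hρR : ρ < R) (ha : g a ≠ 0) :
    log ‖g a‖ ≤ circleAverage (fun z => log⁺ ‖g z‖) a ρ := by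
  have hsub : Metric.closedBall a |ρ| ⊆ Metric.ball a R := by
    rw [abs_of_pos hρ]; exact Metric.closedBall_subset_ball hρR
  have han : AnalyticOnNhd ℂ g (Metric.closedBall a |ρ|) :=
    (hg.analyticOnNhd Metric.isOpen_ball).mono hsub
  have hJ := han.circleAverage_log_norm hρ.ne' ha
  have hnn : 0 ≤ ∑ᶠ u, (MeromorphicOn.divisor g (Metric.closedBall a |ρ|) u : ℝ) *
      Real.log (ρ * ‖a - u‖⁻¹) := by
    refine finsum_nonneg fun u => ?_
    -- at `u = a` the factor is `log 0 = 0`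
    by_cases hu : u ∈ Metric.closedBall a |ρ|
    · refine mul_nonneg (mod_cast MeromorphicOn.AnalyticOnNhd.divisor_nonneg han u) ?_
      rcases eq_or_ne u a with rfl | hne
      · simp
      · refine Real.log_nonneg ?_
        have hpos : 0 < ‖a - u‖ := norm_pos_iff.2 (sub_ne_zero.2 hne.symm)
        rw [← div_eq_mul_inv, one_le_div hpos]
        rwa [mem_closedBall_iff_norm', abs_of_pos hρ] at hu
    · simp [hu]
  refine (le_add_of_nonneg_left hnn).trans (hJ.symm.le.trans ?_)
  have hcont : ContinuousOn (fun z => log⁺ ‖g z‖) (Metric.sphere a |ρ|) :=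
    continuous_posLog.comp_continuousOn
      (hg.continuousOn.mono (Metric.sphere_subset_closedBall.trans hsub)).norm
  refine circleAverage_mono ?_ hcont.circleIntegrable' fun z _ => le_max_right _ _
  exact (han.mono Metric.sphere_subset_closedBall).meromorphicOn.circleIntegrable_log_norm

theorem log_norm_le_lintegral_circle {g : ℂ → ℂ} {a : ℂ} {R ρ : ℝ}
    (hg : DifferentiableOn ℂ g (Metric.ball a R)) (hρ : 0 < ρ) (hρR : ρ < R) (ha : g a ≠ 0) :
    ENNReal.ofReal (2 * π) * ENNReal.ofReal (log ‖g a‖)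
      ≤ ∫⁻ θ in Set.Ioo (-π) π, ENNReal.ofReal (log⁺ ‖g (circleMap a ρ θ)‖) := by
  have h1 := log_norm_le_circleAverage hg hρ hρR ha
  have hper : Function.Periodic (fun θ => log⁺ ‖g (circleMap a ρ θ)‖) (2 * π) := fun θ => by
    simp only [periodic_circleMap a ρ θ]
  have h2 := hper.intervalIntegral_add_eq 0 (-π)
  have e1 : -π + 2 * π = π := by ring
  rw [zero_add, e1] at h2
  have hpi : (0 : ℝ) < 2 * π := by positivity
  rw [Real.circleAverage_def, h2, intervalIntegral.integral_of_le (by linarith [Real.pi_pos]),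
    integral_Ioc_eq_integral_Ioo, smul_eq_mul, le_inv_mul_iff₀ hpi] at h1
  rw [← ENNReal.ofReal_mul hpi.le]
  refine (ENNReal.ofReal_le_ofReal h1).trans ?_
  refine (Real.ofReal_le_enorm _).trans ((enorm_integral_le_lintegral_enorm _).trans_eq ?_)
  exact lintegral_congr fun θ => Real.enorm_of_nonneg posLog_nonneg

theorem measurable_indicator_of_differentiableOn {g : ℂ → ℂ} {a : ℂ} {R : ℝ}
    (hg : DifferentiableOn ℂ g (Metric.ball a R)) :
    Measurable ((Metric.ball a R).indicator g) := by
  classical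
  rw [← Set.piecewise_eq_indicator]
  exact hg.continuousOn.measurable_piecewise continuousOn_const Metric.isOpen_ball.measurableSet

/-- The area form of the sub-mean value property of `log⁺ ‖g‖`. -/
theorem log_norm_mul_volume_le {g : ℂ → ℂ} {a : ℂ} {R : ℝ}
    (hg : DifferentiableOn ℂ g (Metric.ball a R)) (ha : g a ≠ 0) :
    ENNReal.ofReal (log ‖g a‖) * volume (Metric.ball a R)
      ≤ ∫⁻ z in Metric.ball a R, ENNReal.ofReal (log⁺ ‖g z‖) := by
  have hB : MeasurableSet (Metric.ball a R) := Metric.isOpen_ball.measurableSet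
  set F : ℂ → ℝ≥0∞ := (Metric.ball a R).indicator fun z => ENNReal.ofReal (log⁺ ‖g z‖) with hF
  have hFm : Measurable F := by
    have h1 := measurable_indicator_of_differentiableOn hg
    have h2 : F = fun z => ENNReal.ofReal (log⁺ ‖(Metric.ball a R).indicator g z‖) := by
      ext z
      by_cases hz : z ∈ Metric.ball a R <;> simp [hF, hz]
    rw [h2]
    exact ENNReal.measurable_ofReal.comp (continuous_posLog.measurable.comp h1.norm)
  rw [← setLIntegral_const, ← lintegral_indicator hB, ← lintegral_indicator hB, ← hF,
    lintegral_polar a hFm, lintegral_polar a (measurable_const.indicator hB)]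
  refine setLIntegral_mono' measurableSet_Ioi fun ρ hρ => ?_
  rw [Set.mem_Ioi] at hρ
  rw [lintegral_const_mul' _ _ ENNReal.ofReal_ne_top, lintegral_const_mul' _ _ ENNReal.ofReal_ne_top]
  refine mul_le_mul' le_rfl ?_
  rcases lt_or_ge ρ R with h | h
  · have hmem : ∀ θ, circleMap a ρ θ ∈ Metric.ball a R := fun θ => by
      have := circleMap_mem_sphere a hρ.le θ
      rw [mem_sphere_iff_norm] at this
      rw [mem_ball_iff_norm, this]; exact h
    simp only [hF, Set.indicator_of_mem (hmem _)]
    refine le_trans (le_of_eq ?_) (log_norm_le_lintegral_circle hg hρ h ha)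
    rw [setLIntegral_const, Real.volume_Ioo, mul_comm]
    congr 2; ring
  · have hmem : ∀ θ, circleMap a ρ θ ∉ Metric.ball a R := fun θ => by
      have := circleMap_mem_sphere a hρ.le θ
      rw [mem_sphere_iff_norm] at this
      rw [mem_ball_iff_norm, this]; exact h.not_gt
    simp [Set.indicator_of_notMem (hmem _)]

/-- If the mean square of an analytic function over a disc is comparable to its value at the centre,
then the function is not much smaller than that value, except on a set of small measure. -/
theorem volume_sublevel_le {f : ℂ → ℂ} {a : ℂ} {R lam : ℝ} {N : ℝ≥0∞}
    (hf : DifferentiableOn ℂ f (Metric.ball a R)) (ha : f a ≠ 0)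
    (hlam0 : 0 < lam) (hlam1 : lam < 1)
    (hN : ∫⁻ z in Metric.ball a R, ‖f z‖ₑ ^ 2 ≤ N * ‖f a‖ₑ ^ 2) :
    ENNReal.ofReal (-log lam) * volume (Metric.ball a R ∩ {z | ‖f z‖ ≤ lam * ‖f a‖}) ≤ N := by
  have hB : MeasurableSet (Metric.ball a R) := Metric.isOpen_ball.measurableSet
  set L : ℝ := -log lam with hL
  have hL0 : 0 < L := neg_pos.2 (Real.log_neg hlam0 hlam1)
  have hna : 0 < ‖f a‖ := norm_pos_iff.2 ha
  -- `g = f / (lam * f a)` has `log ‖g a‖ = L`; `log⁺ ‖g‖` vanishes on the sublevel set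
  set k : ℂ := (lam : ℂ)⁻¹ * (f a)⁻¹ with hk
  have hk0 : k ≠ 0 := by simp [hk, ha, hlam0.ne']
  have hkn : ∀ z, ‖k * f z‖ = lam⁻¹ * (‖f z‖ / ‖f a‖) := fun z => by
    rw [norm_mul, hk, norm_mul, norm_inv, norm_inv, Complex.norm_real, Real.norm_eq_abs,
      abs_of_pos hlam0]
    ring
  have h1 := log_norm_mul_volume_le (g := fun z => k * f z) (hf.const_mul k) (mul_ne_zero hk0 ha)
  have e1 : log ‖k * f a‖ = L := by
    rw [hkn, div_self hna.ne', mul_one, Real.log_inv]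
  simp only [e1] at h1
  set S : Set ℂ := Metric.ball a R ∩ {z | ‖f z‖ ≤ lam * ‖f a‖} with hS
  have hSm : MeasurableSet S := by
    have h2 := measurable_indicator_of_differentiableOn hf
    have : S = Metric.ball a R ∩ {z | ‖(Metric.ball a R).indicator f z‖ ≤ lam * ‖f a‖} := by
      ext z
      by_cases hz : z ∈ Metric.ball a R <;> simp [hS, hz]
    rw [this]
    exact hB.inter (measurableSet_le h2.norm measurable_const)
  have hpt : ∀ z ∈ Metric.ball a R, ENNReal.ofReal (log⁺ ‖k * f z‖) ≤
      Sᶜ.indicator (fun _ => ENNReal.ofReal L) z + (‖f a‖ₑ ^ 2)⁻¹ * ‖f z‖ₑ ^ 2 := by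
    intro z hz
    have hx : 0 ≤ ‖f z‖ / ‖f a‖ := by positivity
    by_cases hzS : z ∈ S
    · have : log⁺ ‖k * f z‖ = 0 := by
        rw [posLog_eq_zero_iff, abs_norm, hkn, inv_mul_le_iff₀ hlam0, mul_one, div_le_iff₀ hna]
        exact hzS.2
      rw [this, ENNReal.ofReal_zero]
      exact zero_le
    · have hlt : lam < ‖f z‖ / ‖f a‖ := by
        rw [lt_div_iff₀ hna]
        by_contra h
        exact hzS ⟨hz, not_lt.1 h⟩
      have hx0 : 0 < ‖f z‖ / ‖f a‖ := hlam0.trans hlt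
      have e2 : log⁺ ‖k * f z‖ ≤ L + (‖f z‖ / ‖f a‖) ^ 2 := by
        have h3 : log ‖k * f z‖ = L + log (‖f z‖ / ‖f a‖) := by
          rw [hkn, Real.log_mul (inv_ne_zero hlam0.ne') hx0.ne', Real.log_inv]
        have h4 := Real.log_le_sub_one_of_pos hx0
        rw [posLog_apply, h3]
        refine max_le (by positivity) ?_
        nlinarith [sq_nonneg (‖f z‖ / ‖f a‖ - 1)]
      rw [Set.indicator_of_mem (by exact hzS)]
      refine (ENNReal.ofReal_le_ofReal e2).trans ?_
      rw [ENNReal.ofReal_add hL0.le (by positivity)]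
      refine add_le_add le_rfl (le_of_eq ?_)
      rw [div_pow, ENNReal.ofReal_div_of_pos (by positivity), ENNReal.ofReal_pow (norm_nonneg _),
        ENNReal.ofReal_pow (norm_nonneg _), ofReal_norm, ofReal_norm, div_eq_mul_inv, mul_comm]
  have hfa0 : ‖f a‖ₑ ^ 2 ≠ 0 := by simp [ha]
  have hfat : ‖f a‖ₑ ^ 2 ≠ ∞ := by finiteness
  have h5 : ∫⁻ z in Metric.ball a R, ENNReal.ofReal (log⁺ ‖k * f z‖) ≤
      ENNReal.ofReal L * volume (Metric.ball a R \ S) + N := by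
    refine (setLIntegral_mono' hB hpt).trans ?_
    rw [lintegral_add_left (measurable_const.indicator hSm.compl),
      lintegral_indicator_const hSm.compl, Measure.restrict_apply hSm.compl,
      lintegral_const_mul' _ _ (by simpa using hfa0)]
    refine add_le_add (le_of_eq ?_) ?_
    · rw [Set.inter_comm]; rfl
    · refine (mul_le_mul' le_rfl hN).trans (le_of_eq ?_)
      rw [mul_comm N, ← mul_assoc, ENNReal.inv_mul_cancel hfa0 hfat, one_mul]
  have h6 := h1.trans h5
  have hSB : S ⊆ Metric.ball a R := Set.inter_subset_left
  rw [← measure_sdiff_add_inter (Metric.ball a R) hSm, Set.inter_eq_right.2 hSB, mul_add] at h6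
  refine (ENNReal.add_le_add_iff_left ?_).1 h6
  exact ENNReal.mul_ne_top ENNReal.ofReal_ne_top
    (measure_ne_top_of_subset Set.sdiff_subset measure_ball_lt_top.ne)

/-! ### The weighted area measure -/

theorem measurable_weight (α : ℝ) : Measurable (weight α) := by
  unfold weight; fun_prop

theorem ofReal_pi_ne_zero : ENNReal.ofReal π ≠ 0 := by simp [Real.pi_pos]

/-- Integration against `ω_α dA` in terms of Lebesgue measure. -/
theorem lintegral_weightedArea (α : ℝ) (F : ℂ → ℝ≥0∞) :
    ∫⁻ z, F z ∂weightedArea α = (ENNReal.ofReal π)⁻¹ *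
      ∫⁻ z in Metric.ball (0 : ℂ) 1, ENNReal.ofReal (weight α z) * F z := by
  rw [weightedArea, lintegral_withDensity_eq_lintegral_mul_non_measurable _
    (measurable_weight α).ennreal_ofReal (by simp), diskArea, lintegral_smul_measure]
  rfl

theorem diskArea_apply {s : Set ℂ} (hs : MeasurableSet s) :
    diskArea s = (ENNReal.ofReal π)⁻¹ * volume (s ∩ Metric.ball 0 1) := by
  rw [diskArea, Measure.smul_apply, Measure.restrict_apply hs, smul_eq_mul]

theorem ae_mem_ball_diskArea : ∀ᵐ z ∂diskArea, z ∈ Metric.ball (0 : ℂ) 1 :=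
  Measure.ae_smul_measure (ae_restrict_mem Metric.isOpen_ball.measurableSet) _

theorem weightedArea_absolutelyContinuous (α : ℝ) : weightedArea α ≪ diskArea :=
  withDensity_absolutelyContinuous _ _

theorem weight_pos {α : ℝ} (hα : -1 < α) {z : ℂ} (hz : z ∈ Metric.ball (0 : ℂ) 1) :
    0 < weight α z := by
  rw [mem_ball_zero_iff] at hz
  exact mul_pos (by linarith) (Real.rpow_pos_of_pos (by nlinarith [norm_nonneg z]) _)

theorem diskArea_absolutelyContinuous {α : ℝ} (hα : -1 < α) : diskArea ≪ weightedArea α := by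
  refine withDensity_absolutelyContinuous' (measurable_weight α).ennreal_ofReal.aemeasurable ?_
  filter_upwards [ae_mem_ball_diskArea] with z hz
  simpa using weight_pos hα hz

theorem volume_ball_eq (a : ℂ) {r : ℝ} (hr : 0 ≤ r) :
    volume (Metric.ball a r) = ENNReal.ofReal (π * r ^ 2) := by
  rw [Complex.volume_ball, mul_comm, ENNReal.ofReal_mul Real.pi_pos.le, ENNReal.ofReal_pow hr]
  congr 1
  rw [← NNReal.coe_real_pi, ENNReal.ofReal_coe_nnreal]

instance : IsProbabilityMeasure diskArea := ⟨by
  rw [diskArea_apply MeasurableSet.univ, Set.univ_inter, volume_ball_eq 0 zero_le_one]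
  simp only [one_pow, mul_one]
  exact ENNReal.inv_mul_cancel ofReal_pi_ne_zero ENNReal.ofReal_ne_top⟩

theorem rpow_le_rpow_of_comparable {x y k : ℝ} (α : ℝ) (hx : 0 < x) (hy : 0 < y)
    (hxy : x ≤ k * y) (hyx : y ≤ k * x) : x ^ α ≤ k ^ |α| * y ^ α := by
  have hk : 0 < k := by
    by_contra h
    nlinarith
  rcases le_total 0 α with h | h
  · rw [abs_of_nonneg h, ← Real.mul_rpow hk.le hy.le]
    exact Real.rpow_le_rpow hx.le hxy h
  · rw [abs_of_nonpos h, Real.rpow_neg hk.le, ← Real.inv_rpow hk.le,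
      ← Real.mul_rpow (inv_nonneg.2 hk.le) hy.le]
    refine Real.rpow_le_rpow_of_nonpos (by positivity) ?_ h
    rwa [inv_mul_le_iff₀ hk]

/-- The weight and the distance to the boundary are almost constant on a disc that is small
compared with its distance to the boundary. -/
theorem weight_div_le {α : ℝ} (hα : -1 < α) {κ : ℝ} (hκ0 : 0 < κ) (hκ1 : κ < 1) {a z : ℂ}
    (ha : ‖a‖ < 1) (hz : ‖z - a‖ < κ * (1 - ‖a‖)) :
    weight α a / (1 - ‖a‖) ^ 2
      ≤ 4 * (4 / (1 - κ)) ^ |α| * (weight α z / (1 - ‖z‖) ^ 2) := by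
  have h1 : |‖z‖ - ‖a‖| ≤ ‖z - a‖ := abs_norm_sub_norm_le z a
  obtain ⟨h2, h3⟩ := abs_le.1 h1
  have hR : 0 < 1 - ‖a‖ := by linarith
  have hz1 : 1 - ‖z‖ ≤ 2 * (1 - ‖a‖) := by nlinarith
  have hz2 : (1 - κ) * (1 - ‖a‖) ≤ 1 - ‖z‖ := by nlinarith
  have hκ : 0 < 1 - κ := by linarith
  have hzR : 0 < 1 - ‖z‖ := lt_of_lt_of_le (by positivity) hz2
  have na := norm_nonneg a
  have nz := norm_nonneg z
  have ha2 : 0 < 1 - ‖a‖ ^ 2 := by nlinarith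
  have hz3 : 0 < 1 - ‖z‖ ^ 2 := by nlinarith
  have hc1 : 1 - ‖a‖ ^ 2 ≤ 4 / (1 - κ) * (1 - ‖z‖ ^ 2) := by
    rw [div_mul_eq_mul_div, le_div_iff₀ hκ]
    nlinarith
  have hc2 : 1 - ‖z‖ ^ 2 ≤ 4 / (1 - κ) * (1 - ‖a‖ ^ 2) := by
    rw [div_mul_eq_mul_div, le_div_iff₀ hκ]
    nlinarith
  have h4 := rpow_le_rpow_of_comparable α ha2 hz3 hc1 hc2
  have h5 : weight α a ≤ (4 / (1 - κ)) ^ |α| * weight α z := by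
    unfold weight
    nlinarith
  have hw : 0 ≤ weight α z := (weight_pos hα (by simpa using by linarith)).le
  have hk : 0 ≤ (4 / (1 - κ)) ^ |α| := by positivity
  rw [mul_div_assoc', div_le_div_iff₀ (by positivity) (by positivity)]
  have h6 : (1 - ‖z‖) ^ 2 ≤ 4 * (1 - ‖a‖) ^ 2 := by nlinarith
  calc weight α a * (1 - ‖z‖) ^ 2
      ≤ (4 / (1 - κ)) ^ |α| * weight α z * (4 * (1 - ‖a‖) ^ 2) := by gcongr
    _ = _ := by ring

/-! ### Averages over discs -/

/-- Averaging over the discs `B(a, κ (1 - |a|))` is bounded on `L¹(ω_α)`. -/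
theorem lintegral_average_le {α : ℝ} (hα : -1 < α) {κ : ℝ} (hκ0 : 0 < κ) (hκ1 : κ < 1) :
    ∃ C : ℝ, 0 < C ∧ ∀ F : ℂ → ℝ≥0∞, Measurable F →
      ∫⁻ a in Metric.ball (0 : ℂ) 1, ENNReal.ofReal (weight α a / (1 - ‖a‖) ^ 2) *
          ∫⁻ z in Metric.ball a (κ * (1 - ‖a‖)), F z
        ≤ ENNReal.ofReal C *
          ∫⁻ z in Metric.ball (0 : ℂ) 1, ENNReal.ofReal (weight α z) * F z := by
  have hκ : 0 < 1 - κ := by linarith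
  set k : ℝ := 4 * (4 / (1 - κ)) ^ |α| with hk
  have hk0 : 0 < k := by positivity
  have hD : MeasurableSet (Metric.ball (0 : ℂ) 1) := Metric.isOpen_ball.measurableSet
  refine ⟨k * (π * (κ / (1 - κ)) ^ 2), by positivity, fun F hF => ?_⟩
  set W : ℂ → ℝ≥0∞ := fun a => ENNReal.ofReal (weight α a / (1 - ‖a‖) ^ 2) with hW
  have hWm : Measurable W := by
    have := measurable_weight α
    exact ENNReal.measurable_ofReal.comp (by fun_prop)
  set S : Set (ℂ × ℂ) := {p | ‖p.1‖ < 1 ∧ ‖p.2 - p.1‖ < κ * (1 - ‖p.1‖)} with hS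
  have hSm : MeasurableSet S := by
    have h1 : MeasurableSet {p : ℂ × ℂ | ‖p.1‖ < 1} :=
      measurableSet_lt (by fun_prop) (by fun_prop)
    have h2 : MeasurableSet {p : ℂ × ℂ | ‖p.2 - p.1‖ < κ * (1 - ‖p.1‖)} :=
      measurableSet_lt (by fun_prop) (by fun_prop)
    exact h1.inter h2
  have e1 : ∫⁻ a in Metric.ball (0 : ℂ) 1, W a * ∫⁻ z in Metric.ball a (κ * (1 - ‖a‖)), F z
      = ∫⁻ a, ∫⁻ z, S.indicator (fun p => W p.1 * F p.2) (a, z) := by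
    rw [← lintegral_indicator hD]
    refine lintegral_congr fun a => ?_
    by_cases ha : a ∈ Metric.ball (0 : ℂ) 1
    · rw [Set.indicator_of_mem ha, ← lintegral_const_mul _ hF,
        ← lintegral_indicator Metric.isOpen_ball.measurableSet]
      refine lintegral_congr fun z => ?_
      rw [mem_ball_zero_iff] at ha
      by_cases hz : ‖z - a‖ < κ * (1 - ‖a‖)
      · rw [Set.indicator_of_mem (by rwa [mem_ball_iff_norm]),
          Set.indicator_of_mem (by exact ⟨ha, hz⟩)]
      · rw [Set.indicator_of_notMem (by rwa [mem_ball_iff_norm]),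
          Set.indicator_of_notMem (fun h => hz h.2)]
    · rw [Set.indicator_of_notMem ha]
      rw [mem_ball_zero_iff] at ha
      simp [hS, ha]
  -- if `z` lies in the disc around `a`, then `a` lies in a comparable disc around `z`
  have e2 : ∀ a z, S.indicator (fun p => W p.1 * F p.2) (a, z) ≤
      (Metric.ball (0 : ℂ) 1).indicator (fun z => ENNReal.ofReal k * W z * F z *
        (Metric.ball z (κ / (1 - κ) * (1 - ‖z‖))).indicator 1 a) z := by
    intro a z
    by_cases h : (a, z) ∈ S
    · obtain ⟨h1, h2⟩ := h
      simp only at h1 h2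
      have h3 := abs_norm_sub_norm_le z a
      obtain ⟨h4, h5⟩ := abs_le.1 h3
      have hz1 : (1 - κ) * (1 - ‖a‖) ≤ 1 - ‖z‖ := by nlinarith
      have hz : z ∈ Metric.ball (0 : ℂ) 1 := by
        rw [mem_ball_zero_iff]; nlinarith
      have haz : a ∈ Metric.ball z (κ / (1 - κ) * (1 - ‖z‖)) := by
        rw [mem_ball_iff_norm, norm_sub_rev]
        refine h2.trans_le ?_
        rw [div_mul_eq_mul_div, le_div_iff₀ hκ]
        nlinarith
      rw [Set.indicator_of_mem (by exact ⟨h1, h2⟩), Set.indicator_of_mem hz, Set.indicator_of_mem haz]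
      simp only [Pi.one_apply, mul_one]
      refine mul_le_mul' ?_ le_rfl
      rw [hW, ← ENNReal.ofReal_mul hk0.le]
      exact ENNReal.ofReal_le_ofReal (weight_div_le hα hκ0 hκ1 h1 h2)
    · simp [Set.indicator_of_notMem h]
  have hm : Measurable (S.indicator fun p => W p.1 * F p.2) :=
    (by fun_prop : Measurable fun p : ℂ × ℂ => W p.1 * F p.2).indicator hSm
  rw [e1, lintegral_lintegral_swap (by exact hm.aemeasurable)]
  refine (lintegral_mono fun z => lintegral_mono fun a => e2 a z).trans ?_
  rw [← lintegral_const_mul' _ _ ENNReal.ofReal_ne_top, ← lintegral_indicator hD]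
  refine lintegral_mono fun z => ?_
  by_cases hz : z ∈ Metric.ball (0 : ℂ) 1
  · have hw := (weight_pos hα hz).le
    simp only [Set.indicator_of_mem hz]
    rw [mem_ball_zero_iff] at hz
    have hR : 0 < 1 - ‖z‖ := by linarith
    rw [lintegral_const_mul _ (measurable_one.indicator Metric.isOpen_ball.measurableSet),
      lintegral_indicator_one Metric.isOpen_ball.measurableSet,
      volume_ball_eq _ (by positivity), mul_right_comm, hW, ← ENNReal.ofReal_mul hk0.le,
      ← ENNReal.ofReal_mul (by positivity), ← mul_assoc (ENNReal.ofReal _),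
      ← ENNReal.ofReal_mul (by positivity)]
    refine mul_le_mul' (ENNReal.ofReal_le_ofReal (le_of_eq ?_)) le_rfl
    field_simp
  · simp [Set.indicator_of_notMem hz]

/-! ### Density in discs inside the unit disc -/

/-- The area of a rectangle whose sides are parallel and orthogonal to the unit vector `ζ`. -/
theorem volume_rotated_rectangle {ζ : ℂ} (hζ : ‖ζ‖ = 1) (p q t : ℝ) :
    volume {w : ℂ | ((starRingEnd ℂ) ζ * w).re ∈ Set.Icc p q ∧
      ((starRingEnd ℂ) ζ * w).im ∈ Set.Icc (-t) t}
      = ENNReal.ofReal (q - p) * ENNReal.ofReal (2 * t) := by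
  have hc : (starRingEnd ℂ) ζ ∈ Submonoid.unitSphere ℂ := by simp [Submonoid.unitSphere, hζ]
  have h1 := (rotation ⟨(starRingEnd ℂ) ζ, hc⟩).measurePreserving
  have h2 := Complex.volume_preserving_equiv_real_prod.comp h1
  have h3 := h2.measure_preimage
    (measurableSet_Icc.prod measurableSet_Icc : MeasurableSet
      (Set.Icc p q ×ˢ Set.Icc (-t) t)).nullMeasurableSet
  rw [Measure.volume_eq_prod, Measure.prod_prod, Real.volume_Icc, Real.volume_Icc] at h3
  rw [show 2 * t = t - -t by ring, ← h3]
  congr 1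

theorem diskArea_real_apply {s : Set ℂ} (hs : MeasurableSet s) :
    diskArea.real s = π⁻¹ * volume.real (s ∩ Metric.ball 0 1) := by
  rw [measureReal_def, diskArea_apply hs, ENNReal.toReal_mul, ENNReal.toReal_inv,
    ENNReal.toReal_ofReal Real.pi_pos.le, measureReal_def]

theorem volume_real_ball_eq (a : ℂ) {r : ℝ} (hr : 0 ≤ r) :
    volume.real (Metric.ball a r) = π * r ^ 2 := by
  rw [measureReal_def, volume_ball_eq a hr, ENNReal.toReal_ofReal (by positivity)]

/-- A disc centred on the unit circle meets the unit disc in a set of comparable area. -/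
theorem le_volume_ball_inter_ball {ζ : ℂ} (hζ : ‖ζ‖ = 1) {t : ℝ} (ht0 : 0 < t) (ht : t ≤ 1) :
    π * (t / 2) ^ 2 ≤ volume.real (Metric.ball (0 : ℂ) 1 ∩ Metric.ball ζ t) := by
  rw [← volume_real_ball_eq (((1 - t / 2 : ℝ) : ℂ) * ζ) (by positivity)]
  refine measureReal_mono (fun w hw => ?_)
    (measure_ne_top_of_subset Set.inter_subset_left measure_ball_lt_top.ne)
  rw [mem_ball_iff_norm] at hw
  have n1 : ‖((1 - t / 2 : ℝ) : ℂ) * ζ‖ = 1 - t / 2 := by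
    rw [norm_mul, hζ, mul_one, Complex.norm_real, Real.norm_eq_abs, abs_of_nonneg (by linarith)]
  have n2 : ‖((1 - t / 2 : ℝ) : ℂ) * ζ - ζ‖ = t / 2 := by
    have : ((1 - t / 2 : ℝ) : ℂ) * ζ - ζ = ((-(t / 2) : ℝ) : ℂ) * ζ := by push_cast; ring
    rw [this, norm_mul, hζ, mul_one, Complex.norm_real, Real.norm_eq_abs, abs_neg,
      abs_of_nonneg (by positivity)]
  refine ⟨?_, ?_⟩
  · rw [mem_ball_zero_iff]
    have := norm_le_norm_add_norm_sub' w (((1 - t / 2 : ℝ) : ℂ) * ζ)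
    linarith
  · rw [mem_ball_iff_norm]
    have := norm_sub_le_norm_sub_add_norm_sub w (((1 - t / 2 : ℝ) : ℂ) * ζ) ζ
    linarith

theorem exists_unit_direction (a : ℂ) : ∃ ζ : ℂ, ‖ζ‖ = 1 ∧ a = ‖a‖ * ζ := by
  rcases eq_or_ne a 0 with rfl | ha
  · exact ⟨1, by simp, by simp⟩
  · have hn : (‖a‖ : ℂ) ≠ 0 := by simpa using ha
    refine ⟨a / ‖a‖, ?_, by field_simp⟩
    rw [norm_div, Complex.norm_real, norm_norm, div_self (by simpa using ha)]

/-- A small disc around the boundary point nearest to `a` meets the unit disc in a set which, up to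
a thin rectangle, lies in a disc around `a` slightly smaller than `B(a, 1 - |a|)`: the circles
`|w| = 1` and `|w - a| = 1 - |a|` are tangent. -/
theorem volume_ball_inter_sdiff_le {a ζ : ℂ} (hζ : ‖ζ‖ = 1) (haζ : a = ‖a‖ * ζ) (ha : ‖a‖ < 1)
    {κ τ : ℝ} (hτ : 0 < τ) (hκ0 : 0 ≤ κ) (hκ : κ ^ 2 = 1 - τ ^ 2) :
    volume.real ((Metric.ball (0 : ℂ) 1 ∩ Metric.ball ζ (τ * (1 - ‖a‖))) \
      Metric.ball a (κ * (1 - ‖a‖))) ≤ 2 * τ ^ 3 * (1 - ‖a‖) ^ 2 := by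
  set R := 1 - ‖a‖ with hR
  have hR0 : 0 < R := by linarith
  have hrect := volume_rotated_rectangle hζ (1 - τ ^ 2 * R) 1 (τ * R)
  rw [← ENNReal.ofReal_mul (by ring_nf; positivity)] at hrect
  have e1 : 2 * τ ^ 3 * R ^ 2 = (1 - (1 - τ ^ 2 * R)) * (2 * (τ * R)) := by ring
  rw [e1, ← ENNReal.toReal_ofReal (r := (1 - (1 - τ ^ 2 * R)) * (2 * (τ * R)))
    (by rw [← e1]; positivity), ← hrect]
  refine measureReal_mono (fun w hw => ?_) (by rw [hrect]; exact ENNReal.ofReal_ne_top)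
  obtain ⟨⟨h1, h2⟩, h3⟩ := hw
  rw [mem_ball_zero_iff] at h1
  rw [mem_ball_iff_norm] at h2 h3
  have hcc : (starRingEnd ℂ) ζ * ζ = 1 := by
    rw [mul_comm, Complex.mul_conj, Complex.normSq_eq_norm_sq, hζ]; simp
  have hrot : ∀ v : ℂ, ‖v‖ ^ 2 = Complex.normSq ((starRingEnd ℂ) ζ * v) := fun v => by
    rw [Complex.normSq_eq_norm_sq, norm_mul, Complex.norm_conj, hζ, one_mul]
  set u := (starRingEnd ℂ) ζ * w with hu
  have r1 : u.re ^ 2 + u.im ^ 2 < 1 := by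
    have h4 : ‖w‖ ^ 2 < 1 := by nlinarith [norm_nonneg w]
    rw [hrot, Complex.normSq_apply] at h4
    nlinarith
  have r2 : (u.re - 1) ^ 2 + u.im ^ 2 < (τ * R) ^ 2 := by
    have h4 : ‖w - ζ‖ ^ 2 < (τ * R) ^ 2 := by
      have : 0 < τ * R := by positivity
      nlinarith [norm_nonneg (w - ζ)]
    rw [hrot, mul_sub, hcc, Complex.normSq_apply] at h4
    simp only [← hu, Complex.sub_re, Complex.sub_im, Complex.one_re, Complex.one_im] at h4
    nlinarith
  have r3 : (κ * R) ^ 2 ≤ (u.re - (1 - R)) ^ 2 + u.im ^ 2 := by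
    have h4 : (κ * R) ^ 2 ≤ ‖w - a‖ ^ 2 := by
      have : 0 ≤ κ * R := by positivity
      nlinarith [norm_nonneg (w - a)]
    have h5 : (starRingEnd ℂ) ζ * a = ((1 - R : ℝ) : ℂ) := by
      rw [haζ, mul_left_comm, hcc, mul_one, hR]; simp
    rw [hrot, mul_sub _ w a, h5, Complex.normSq_apply] at h4
    simp only [← hu, Complex.sub_re, Complex.sub_im, Complex.ofReal_re, Complex.ofReal_im] at h4
    nlinarith
  have r4 : (1 - u.re) * (2 * R) ≤ τ ^ 2 * R * (2 * R) := by
    rw [mul_pow, hκ] at r3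
    nlinarith
  have r5 : |u.im| ≤ τ * R := by
    refine abs_le_of_sq_le_sq ?_ (by positivity)
    nlinarith [sq_nonneg (u.re - 1)]
  have r6 := le_of_mul_le_mul_right r4 (by positivity)
  refine ⟨⟨by linarith, ?_⟩, abs_le.1 r5⟩
  nlinarith [sq_nonneg u.im]

/-- The boundary density condition passes to discs `B(a, κ (1 - |a|))` inside the unit disc. -/
theorem IsBoundaryDense.exists_le_volume_inter_ball {G : Set ℂ} (hG : MeasurableSet G)
    (h : IsBoundaryDense G) : ∃ κ c : ℝ, 0 < κ ∧ κ < 1 ∧ 0 < c ∧ ∀ a : ℂ, ‖a‖ < 1 →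
      ENNReal.ofReal (c * (1 - ‖a‖) ^ 2) ≤ volume (G ∩ Metric.ball a (κ * (1 - ‖a‖))) := by
  obtain ⟨δ, hδ0, hδ1, h⟩ := h
  -- in the disc of radius `τ (1 - ‖a‖)` the thin rectangle then takes less than the share `δ`
  set τ : ℝ := δ / 8 with hτ
  have hτ0 : 0 < τ := by positivity
  have hτ1 : τ < 1 := by rw [hτ]; linarith
  have hpos : 0 < 1 - τ ^ 2 := by nlinarith
  refine ⟨√(1 - τ ^ 2), τ ^ 3, Real.sqrt_pos.2 hpos, ?_, by positivity, fun a ha => ?_⟩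
  · rw [Real.sqrt_lt' one_pos]; nlinarith
  obtain ⟨ζ, hζ, haζ⟩ := exists_unit_direction a
  set κ := √(1 - τ ^ 2)
  have hthin := volume_ball_inter_sdiff_le (κ := κ) hζ haζ ha hτ0 (Real.sqrt_nonneg _)
    (Real.sq_sqrt hpos.le)
  set R := 1 - ‖a‖ with hR
  have hR0 : 0 < R := by linarith
  have hR1 : R ≤ 1 := by have := norm_nonneg a; linarith
  have ht0 : 0 < τ * R := by positivity
  have hB : ∀ (z : ℂ) (r : ℝ), MeasurableSet (Metric.ball z r) :=
    fun z r => Metric.isOpen_ball.measurableSet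
  have h1 := h ζ (τ * R) hζ ht0
  rw [diskArea_real_apply ((hB 0 1).inter (hB _ _)), diskArea_real_apply (hG.inter (hB _ _)),
    Set.inter_right_comm, Set.inter_self, mul_left_comm] at h1
  have h2 := le_of_mul_le_mul_left h1 (by positivity)
  have h3 := le_volume_ball_inter_ball hζ ht0 (by nlinarith)
  have hfin : ∀ s : Set ℂ, volume (s ∩ Metric.ball 0 1) ≠ ∞ := fun s =>
    measure_ne_top_of_subset Set.inter_subset_right measure_ball_lt_top.ne
  have hfin' : volume (G ∩ Metric.ball a (κ * R)) ≠ ∞ :=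
    measure_ne_top_of_subset Set.inter_subset_right measure_ball_lt_top.ne
  have h4 : volume.real (G ∩ Metric.ball ζ (τ * R) ∩ Metric.ball 0 1) ≤
      volume.real (G ∩ Metric.ball a (κ * R)) +
      volume.real ((Metric.ball (0 : ℂ) 1 ∩ Metric.ball ζ (τ * R)) \ Metric.ball a (κ * R)) := by
    have hfin2 : volume ((Metric.ball (0 : ℂ) 1 ∩ Metric.ball ζ (τ * R)) \
        Metric.ball a (κ * R)) ≠ ∞ :=
      measure_ne_top_of_subset (Set.sdiff_subset.trans Set.inter_subset_left)
        measure_ball_lt_top.ne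
    refine (measureReal_mono (fun w hw => ?_) (measure_union_ne_top hfin' hfin2)).trans
      (measureReal_union_le _ _)
    by_cases hwa : w ∈ Metric.ball a (κ * R)
    · exact Or.inl ⟨hw.1.1, hwa⟩
    · exact Or.inr ⟨⟨hw.2, hw.1.2⟩, hwa⟩
  have h5 : 3 * τ ^ 3 * R ^ 2 ≤ δ * (π * (τ * R / 2) ^ 2) := by
    have hδ : δ = 8 * τ := by rw [hτ]; ring
    rw [hδ]
    have h6 : 0 ≤ τ ^ 3 * R ^ 2 := by positivity
    nlinarith [Real.pi_gt_three]
  rw [← ENNReal.ofReal_toReal hfin']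
  refine ENNReal.ofReal_le_ofReal ?_
  change _ ≤ volume.real (G ∩ Metric.ball a (κ * R))
  have h7 := mul_le_mul_of_nonneg_left h3 hδ0.le
  linarith

/-! ### Density implies the reverse Carleson inequality -/

theorem le_two_mul_of_le_half_add {X Y : ℝ≥0∞} (hX : X ≠ ∞)
    (h : X ≤ ENNReal.ofReal (1 / 2) * X + Y) : X ≤ 2 * Y := by
  rcases eq_or_ne Y ∞ with rfl | hY
  · simp
  lift X to NNReal using hX
  lift Y to NNReal using hY
  rw [show ENNReal.ofReal (1 / 2) = ((1 / 2 : NNReal) : ℝ≥0∞) by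
    rw [← ENNReal.ofReal_coe_nnreal]; norm_num] at h
  norm_cast at h ⊢
  have h' : (X : ℝ) ≤ 1 / 2 * X + Y := by exact_mod_cast h
  have : (X : ℝ) ≤ 2 * Y := by linarith
  exact_mod_cast this

/-- At each point `a`, either `|f(a)|²` is small compared with the mean of `|f|²` over
`B = B(a, κ (1 - |a|))`, or it is controlled by the mean of `|f|²` over `G ∩ B`. -/
theorem enorm_sq_mul_le_of_le_volume {G : Set ℂ} (hG : MeasurableSet G) {κ c η : ℝ} (hκ1 : κ < 1)
    (hc : 0 < c) (hη : 0 < η) {f : ℂ → ℂ} (hf : DifferentiableOn ℂ f (Metric.ball 0 1)) {a : ℂ}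
    (ha : ‖a‖ < 1)
    (hGa : ENNReal.ofReal (c * (1 - ‖a‖) ^ 2) ≤ volume (G ∩ Metric.ball a (κ * (1 - ‖a‖)))) :
    ‖f a‖ₑ ^ 2 * ENNReal.ofReal ((1 - ‖a‖) ^ 2) ≤
      ENNReal.ofReal η * (∫⁻ z in Metric.ball a (κ * (1 - ‖a‖)), ‖f z‖ₑ ^ 2) +
      ENNReal.ofReal (2 / (c * rexp (-(2 / (c * η))) ^ 2)) *
        ∫⁻ z in G ∩ Metric.ball a (κ * (1 - ‖a‖)), ‖f z‖ₑ ^ 2 := by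
  set R := 1 - ‖a‖ with hR
  have hR0 : 0 < R := by linarith
  set B := Metric.ball a (κ * R) with hBdef
  have hB : MeasurableSet B := Metric.isOpen_ball.measurableSet
  -- with this `L` the exceptional set `S` below has at most half the area of `G ∩ B`
  set L : ℝ := 2 / (c * η) with hL
  have hL0 : 0 < L := by positivity
  set lam : ℝ := rexp (-L) with hlam
  have hlam0 : 0 < lam := Real.exp_pos _
  have hlam1 : lam < 1 := by rw [hlam, Real.exp_lt_one_iff]; linarith
  have hlog : -Real.log lam = L := by rw [hlam, Real.log_exp, neg_neg]
  rcases le_or_gt (‖f a‖ₑ ^ 2 * ENNReal.ofReal (R ^ 2))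
    (ENNReal.ofReal η * ∫⁻ z in B, ‖f z‖ₑ ^ 2) with hbad | hgood
  · exact hbad.trans le_self_add
  have hfa : f a ≠ 0 := by
    rintro h0
    simp [h0] at hgood
  have hBD : B ⊆ Metric.ball 0 1 := by
    refine Metric.ball_subset_ball' ?_
    rw [dist_zero_right]
    nlinarith
  have hN : ∫⁻ z in B, ‖f z‖ₑ ^ 2 ≤ ENNReal.ofReal (R ^ 2 / η) * ‖f a‖ₑ ^ 2 := by
    rw [ENNReal.ofReal_div_of_pos hη, div_eq_mul_inv, mul_right_comm, ← div_eq_mul_inv,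
      ENNReal.le_div_iff_mul_le (by simp [hη]) (by simp), mul_comm,
      mul_comm (ENNReal.ofReal (R ^ 2))]
    exact hgood.le
  have h1 := volume_sublevel_le (hf.mono hBD) hfa hlam0 hlam1 hN
  rw [hlog] at h1
  set S : Set ℂ := B ∩ {z | ‖f z‖ ≤ lam * ‖f a‖} with hS
  have h2 : volume S ≤ ENNReal.ofReal (c / 2 * R ^ 2) := by
    have e1 : ENNReal.ofReal (R ^ 2 / η) = ENNReal.ofReal L * ENNReal.ofReal (c / 2 * R ^ 2) := by
      rw [← ENNReal.ofReal_mul hL0.le, hL]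
      congr 1
      field_simp
    rw [e1] at h1
    exact (ENNReal.mul_le_mul_iff_right (by simp [hL0]) ENNReal.ofReal_ne_top).1 h1
  have hSm : MeasurableSet S := by
    have h2 := measurable_indicator_of_differentiableOn (hf.mono hBD)
    have : S = B ∩ {z | ‖B.indicator f z‖ ≤ lam * ‖f a‖} := by
      ext z
      by_cases hz : z ∈ B <;> simp [hS, hz]
    rw [this]
    exact hB.inter (measurableSet_le h2.norm measurable_const)
  have h3 : ENNReal.ofReal (c / 2 * R ^ 2) ≤ volume ((G ∩ B) \ S) := by
    have h4 : volume (G ∩ B) ≤ volume ((G ∩ B) \ S) + volume S :=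
      (measure_mono (Set.subset_sdiff_union _ _)).trans (measure_union_le _ _)
    have e2 : ENNReal.ofReal (c * R ^ 2) =
        ENNReal.ofReal (c / 2 * R ^ 2) + ENNReal.ofReal (c / 2 * R ^ 2) := by
      rw [← ENNReal.ofReal_add (by positivity) (by positivity)]
      congr 1; ring
    have h5 := (hGa.trans h4).trans (add_le_add le_rfl h2)
    rw [e2] at h5
    exact (ENNReal.add_le_add_iff_right ENNReal.ofReal_ne_top).1 h5
  have h6 : ENNReal.ofReal (lam ^ 2) * ‖f a‖ₑ ^ 2 * ENNReal.ofReal (c / 2 * R ^ 2) ≤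
      ∫⁻ z in G ∩ B, ‖f z‖ₑ ^ 2 := by
    calc _ ≤ ENNReal.ofReal (lam ^ 2) * ‖f a‖ₑ ^ 2 * volume ((G ∩ B) \ S) := by gcongr
      _ = ∫⁻ _z in (G ∩ B) \ S, ENNReal.ofReal (lam ^ 2) * ‖f a‖ₑ ^ 2 := by
          rw [setLIntegral_const]
      _ ≤ ∫⁻ z in (G ∩ B) \ S, ‖f z‖ₑ ^ 2 := by
          refine setLIntegral_mono' ((hG.inter hB).diff hSm) fun z hz => ?_
          have h7 : lam * ‖f a‖ < ‖f z‖ := by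
            by_contra h
            exact hz.2 ⟨hz.1.2, not_lt.1 h⟩
          rw [ENNReal.ofReal_pow hlam0.le, ← mul_pow, ← ofReal_norm, ← ofReal_norm,
            ← ENNReal.ofReal_mul hlam0.le]
          gcongr
      _ ≤ _ := lintegral_mono_set Set.sdiff_subset
  refine le_trans (le_of_eq ?_) ((mul_le_mul' le_rfl h6).trans le_add_self)
  have e3 : ENNReal.ofReal (R ^ 2) = ENNReal.ofReal (2 / (c * lam ^ 2)) *
      (ENNReal.ofReal (lam ^ 2) * ENNReal.ofReal (c / 2 * R ^ 2)) := by
    rw [← ENNReal.ofReal_mul (by positivity), ← ENNReal.ofReal_mul (by positivity)]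
    congr 1
    field_simp
  rw [e3]
  ring

/-- A set satisfying the boundary density condition carries a fixed proportion of the `L²(ω_α)`
norm of every analytic function. -/
theorem IsBoundaryDense.exists_lintegral_le {α : ℝ} (hα : -1 < α) {G : Set ℂ}
    (hG : MeasurableSet G) (h : IsBoundaryDense G) :
    ∃ C : ℝ, 0 < C ∧ ∀ f : ℂ → ℂ, DifferentiableOn ℂ f (Metric.ball 0 1) →
      ∫⁻ z, ‖f z‖ₑ ^ 2 ∂weightedArea α ≠ ∞ →
      ∫⁻ z, ‖f z‖ₑ ^ 2 ∂weightedArea α ≤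
        ENNReal.ofReal C * ∫⁻ z in G, ‖f z‖ₑ ^ 2 ∂weightedArea α := by
  obtain ⟨κ, c, hκ0, hκ1, hc, hGa⟩ := h.exists_le_volume_inter_ball hG
  obtain ⟨C₁, hC₁, hav⟩ := lintegral_average_le hα hκ0 hκ1
  -- makes the contribution of the points where `f` is small at most half of the norm
  set η : ℝ := 1 / (2 * C₁) with hη
  have hη0 : 0 < η := by positivity
  set K : ℝ := 2 / (c * rexp (-(2 / (c * η))) ^ 2) with hK
  have hK0 : 0 < K := by positivity
  refine ⟨2 * (C₁ * K), by positivity, fun f hf hfin => ?_⟩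
  have hD : MeasurableSet (Metric.ball (0 : ℂ) 1) := Metric.isOpen_ball.measurableSet
  set F : ℂ → ℝ≥0∞ := fun z => ‖(Metric.ball (0 : ℂ) 1).indicator f z‖ₑ ^ 2 with hF
  have hFm : Measurable F := (measurable_indicator_of_differentiableOn hf).enorm.pow_const 2
  have hFD : ∀ z ∈ Metric.ball (0 : ℂ) 1, F z = ‖f z‖ₑ ^ 2 := fun z hz => by
    simp only [hF, Set.indicator_of_mem hz]
  have hwm := (measurable_weight α).ennreal_ofReal
  set I : (ℂ → ℝ≥0∞) → ℝ≥0∞ :=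
    fun H => ∫⁻ z in Metric.ball (0 : ℂ) 1, ENNReal.ofReal (weight α z) * H z with hI
  have eI : I F = ∫⁻ z in Metric.ball (0 : ℂ) 1, ENNReal.ofReal (weight α z) * ‖f z‖ₑ ^ 2 :=
    setLIntegral_congr_fun hD fun z hz => by simp only [hFD z hz]
  have eG : I (G.indicator F) = ∫⁻ z in Metric.ball (0 : ℂ) 1,
      ENNReal.ofReal (weight α z) * G.indicator (fun z => ‖f z‖ₑ ^ 2) z :=
    setLIntegral_congr_fun hD fun z hz => by
      by_cases hzG : z ∈ G <;> simp [hzG, hFD z hz]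
  have key : I F ≤ ENNReal.ofReal (1 / 2) * I F +
      ENNReal.ofReal (C₁ * K) * I (G.indicator F) := by
    -- both alternatives at a point are covered by averaging the single function `H`
    set H : ℂ → ℝ≥0∞ := fun z => ENNReal.ofReal η * F z + ENNReal.ofReal K * G.indicator F z with hH
    have hFG : Measurable (G.indicator F) := hFm.indicator hG
    have hHm : Measurable H := (hFm.const_mul _).add (hFG.const_mul _)
    have h1 := hav H hHm
    have h2 : I H = ENNReal.ofReal η * I F + ENNReal.ofReal K * I (G.indicator F) := by
      simp only [hI, hH, mul_add]
      rw [lintegral_add_left (by fun_prop), ← lintegral_const_mul _ (by fun_prop),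
        ← lintegral_const_mul _ (by fun_prop)]
      simp only [mul_left_comm]
    have h3 : ENNReal.ofReal C₁ * I H = ENNReal.ofReal (1 / 2) * I F +
        ENNReal.ofReal (C₁ * K) * I (G.indicator F) := by
      rw [h2, mul_add, ← mul_assoc, ← mul_assoc, ← ENNReal.ofReal_mul hC₁.le,
        ← ENNReal.ofReal_mul hC₁.le]
      congr 3
      rw [hη]; field_simp
    rw [← h3]
    refine le_trans ?_ h1
    refine setLIntegral_mono' hD fun a ha => ?_
    have hw := (weight_pos hα ha).le
    rw [hFD a ha]
    rw [mem_ball_zero_iff] at ha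
    have hR0 : 0 < 1 - ‖a‖ := by linarith
    have hB : MeasurableSet (Metric.ball a (κ * (1 - ‖a‖))) := Metric.isOpen_ball.measurableSet
    have hBD : ∀ z ∈ Metric.ball a (κ * (1 - ‖a‖)), z ∈ Metric.ball (0 : ℂ) 1 := by
      refine fun z hz => Metric.ball_subset_ball' ?_ hz
      rw [dist_zero_right]
      nlinarith
    have h4 := enorm_sq_mul_le_of_le_volume hG hκ1 hc hη0 hf ha (hGa a ha)
    have h5 : ∫⁻ z in Metric.ball a (κ * (1 - ‖a‖)), H z =
        ENNReal.ofReal η * (∫⁻ z in Metric.ball a (κ * (1 - ‖a‖)), ‖f z‖ₑ ^ 2) +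
        ENNReal.ofReal K * ∫⁻ z in G ∩ Metric.ball a (κ * (1 - ‖a‖)), ‖f z‖ₑ ^ 2 := by
      rw [hH, lintegral_add_left (hFm.const_mul _), lintegral_const_mul _ hFm,
        lintegral_const_mul _ hFG, lintegral_indicator hG, Measure.restrict_restrict hG,
        setLIntegral_congr_fun hB fun z hz => hFD z (hBD z hz),
        setLIntegral_congr_fun (hG.inter hB) fun z hz => hFD z (hBD z hz.2)]
    rw [h5]
    refine le_trans (le_of_eq ?_) (mul_le_mul' le_rfl h4)
    rw [mul_left_comm, ← ENNReal.ofReal_mul (by positivity),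
      div_mul_cancel₀ _ (by positivity), mul_comm]
  have hIfin : I F ≠ ∞ := by
    rw [lintegral_weightedArea, ← eI] at hfin
    intro h0
    rw [h0] at hfin
    exact hfin (ENNReal.mul_top (by simp))
  have h6 := le_two_mul_of_le_half_add hIfin key
  rw [← lintegral_indicator hG, lintegral_weightedArea, lintegral_weightedArea, ← eI, ← eG]
  calc (ENNReal.ofReal π)⁻¹ * I F
      ≤ (ENNReal.ofReal π)⁻¹ * (2 * (ENNReal.ofReal (C₁ * K) * I (G.indicator F))) := by gcongr
    _ = _ := by
      rw [ENNReal.ofReal_mul zero_le_two, show ENNReal.ofReal 2 = 2 by simp]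
      ring

/-! ### Weighted area near the boundary -/

theorem lintegral_comp_unit_mul {ζ : ℂ} (hζ : ‖ζ‖ = 1) {F : ℂ → ℝ≥0∞} (hF : Measurable F) :
    ∫⁻ w, F w = ∫⁻ w, F (ζ * w) := by
  have hc : ζ ∈ Submonoid.unitSphere ℂ := by simp [Submonoid.unitSphere, hζ]
  exact ((rotation ⟨ζ, hc⟩).measurePreserving.lintegral_comp hF).symm

theorem lintegral_rpow_one_sub {α : ℝ} (hα : -1 < α) {s : ℝ} (hs : 0 < s) :
    ∫⁻ ρ in Set.Ioo (1 - s) 1, ENNReal.ofReal ((1 - ρ) ^ α)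
      = ENNReal.ofReal (s ^ (1 + α) / (1 + α)) := by
  have h1 : ∫⁻ ρ in Set.Ioo (1 - s) 1, ENNReal.ofReal ((1 - ρ) ^ α)
      = ∫⁻ x in Set.Ioo 0 s, ENNReal.ofReal (x ^ α) := by
    rw [← lintegral_indicator measurableSet_Ioo, ← lintegral_indicator measurableSet_Ioo,
      ← lintegral_sub_left_eq_self _ 1]
    refine lintegral_congr fun x => ?_
    by_cases hx : x ∈ Set.Ioo 0 s
    · rw [Set.indicator_of_mem hx, Set.indicator_of_mem
        (Set.mem_Ioo.2 ⟨by linarith [hx.2], by linarith [hx.1]⟩), sub_sub_cancel]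
    · rw [Set.indicator_of_notMem hx, Set.indicator_of_notMem
        (fun h => hx (Set.mem_Ioo.2 ⟨by linarith [h.2], by linarith [h.1]⟩))]
  have hint : IntegrableOn (fun x : ℝ => x ^ α) (Set.Ioo 0 s) := by
    have := (intervalIntegral.intervalIntegrable_rpow' (a := 0) (b := s) hα)
    rw [intervalIntegrable_iff_integrableOn_Ioo_of_le hs.le] at this
    exact this
  rw [h1, ← ofReal_integral_eq_lintegral_ofReal hint
    ((ae_restrict_mem measurableSet_Ioo).mono fun x hx => Real.rpow_nonneg hx.1.le _),
    ← integral_Ioc_eq_integral_Ioo, ← intervalIntegral.integral_of_le hs.le,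
    integral_rpow (Or.inl hα), Real.zero_rpow (by linarith), sub_zero, add_comm α]

/-- Points of the unit disc close to `1` have small argument. -/
theorem abs_le_pi_mul_norm_circleMap_sub_one {ρ θ : ℝ} (hρ : 0 < ρ) (hρ1 : ρ < 1)
    (hθ : θ ∈ Set.Ioo (-π) π) : |θ| ≤ π * ‖circleMap 0 ρ θ - 1‖ := by
  have hθ' : |θ| < π := abs_lt.2 hθ
  have h1 : ‖circleMap 0 1 θ - 1‖ = 2 * Real.sin (|θ| / 2) := by
    have e1 : circleMap 0 1 θ = Complex.exp (Complex.I * θ) := by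
      simp [circleMap, mul_comm]
    rw [e1, Complex.norm_exp_I_mul_ofReal_sub_one, Real.norm_eq_abs, abs_mul,
      abs_of_pos (two_pos : (0 : ℝ) < 2)]
    congr 1
    have h2 : |θ| / 2 = |θ / 2| := by rw [abs_div, abs_of_pos (two_pos : (0 : ℝ) < 2)]
    rw [h2, Real.abs_sin_eq_sin_abs_of_abs_le_pi]
    rw [← h2]; linarith [Real.pi_pos]
  have h2 : 2 / π * (|θ| / 2) ≤ Real.sin (|θ| / 2) :=
    Real.mul_le_sin (by positivity) (by linarith)
  have h3 : ‖circleMap 0 1 θ - circleMap 0 ρ θ‖ = 1 - ρ := by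
    have : circleMap 0 1 θ - circleMap 0 ρ θ = ((1 - ρ : ℝ) : ℂ) * circleMap 0 1 θ := by
      simp [circleMap]; ring
    rw [this, norm_mul, norm_circleMap_zero, Complex.norm_real, Real.norm_eq_abs,
      abs_of_pos (by linarith)]
    simp
  have h4 : 1 - ρ ≤ ‖circleMap 0 ρ θ - 1‖ := by
    have := norm_sub_norm_le (1 : ℂ) (circleMap 0 ρ θ)
    rwa [norm_one, norm_circleMap_zero, abs_of_pos hρ, norm_sub_rev] at this
  have h5 := norm_sub_le_norm_sub_add_norm_sub (circleMap 0 1 θ) (circleMap 0 ρ θ) 1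
  have h6 : 2 / π * (|θ| / 2) ≤ ‖circleMap 0 ρ θ - 1‖ := by linarith
  have h7 : 2 / π * (|θ| / 2) = |θ| / π := by ring
  rwa [h7, div_le_iff₀' Real.pi_pos] at h6

theorem weight_le {α : ℝ} (hα : -1 < α) {z : ℂ} (hz : ‖z‖ < 1) :
    weight α z ≤ (1 + α) * (2 ^ |α| * (1 - ‖z‖) ^ α) := by
  have := norm_nonneg z
  refine mul_le_mul_of_nonneg_left ?_ (by linarith)
  exact rpow_le_rpow_of_comparable α (by nlinarith) (by linarith) (by nlinarith) (by nlinarith)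

theorem le_weight {α : ℝ} (hα : -1 < α) {z : ℂ} (hz : ‖z‖ < 1) :
    (1 + α) * (1 - ‖z‖) ^ α ≤ 2 ^ |α| * weight α z := by
  have := norm_nonneg z
  rw [weight, mul_left_comm]
  refine mul_le_mul_of_nonneg_left ?_ (by linarith)
  exact rpow_le_rpow_of_comparable α (by linarith) (by nlinarith) (by nlinarith) (by nlinarith)

theorem weightedArea_apply (α : ℝ) {s : Set ℂ} (hs : MeasurableSet s) :
    weightedArea α s = (ENNReal.ofReal π)⁻¹ *
      ∫⁻ z, (s ∩ Metric.ball 0 1).indicator (fun z => ENNReal.ofReal (weight α z)) z := by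
  rw [← lintegral_indicator_one hs, lintegral_weightedArea,
    ← lintegral_indicator Metric.isOpen_ball.measurableSet, Set.inter_comm]
  congr 1
  refine lintegral_congr fun z => ?_
  by_cases h1 : z ∈ Metric.ball (0 : ℂ) 1 <;> by_cases h2 : z ∈ s <;> simp [h1, h2]

/-- The `ω_α`-area of the part of a boundary disc within distance `s` of the unit circle. -/
theorem weightedArea_strip_le {α : ℝ} (hα : -1 < α) {ζ : ℂ} (hζ : ‖ζ‖ = 1) {r s : ℝ}
    (hr : 0 < r) (hs : 0 < s) :
    weightedArea α (Metric.ball ζ r ∩ {w | 1 - s < ‖w‖}) ≤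
      ENNReal.ofReal (2 * 2 ^ |α| * r * s ^ (1 + α)) := by
  have hα1 : 0 < 1 + α := by linarith
  have hE : ∀ ξ : ℂ, MeasurableSet (Metric.ball ξ r ∩ {w | 1 - s < ‖w‖}) := fun ξ =>
    Metric.isOpen_ball.measurableSet.inter (measurableSet_lt measurable_const (by fun_prop))
  have hD : MeasurableSet (Metric.ball (0 : ℂ) 1) := Metric.isOpen_ball.measurableSet
  have hwm := (measurable_weight α).ennreal_ofReal
  rw [weightedArea_apply α (hE ζ), lintegral_comp_unit_mul hζ (hwm.indicator ((hE ζ).inter hD))]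
  -- rotate `ζ` to `1`
  have e1 : ∀ w : ℂ, (Metric.ball ζ r ∩ {w | 1 - s < ‖w‖} ∩ Metric.ball 0 1).indicator
        (fun z => ENNReal.ofReal (weight α z)) (ζ * w) =
      (Metric.ball 1 r ∩ {w | 1 - s < ‖w‖} ∩ Metric.ball 0 1).indicator
        (fun z => ENNReal.ofReal (weight α z)) w := by
    intro w
    have n1 : ‖ζ * w‖ = ‖w‖ := by rw [norm_mul, hζ, one_mul]
    have n2 : ‖ζ * w - ζ‖ = ‖w - 1‖ := by
      rw [← mul_sub_one, norm_mul, hζ, one_mul]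
    have hiff : ζ * w ∈ Metric.ball ζ r ∩ {w | 1 - s < ‖w‖} ∩ Metric.ball 0 1 ↔
        w ∈ Metric.ball 1 r ∩ {w | 1 - s < ‖w‖} ∩ Metric.ball 0 1 := by
      have h3 : ζ * w ∈ {w : ℂ | 1 - s < ‖w‖} ↔ w ∈ {w : ℂ | 1 - s < ‖w‖} := by
        change 1 - s < ‖ζ * w‖ ↔ 1 - s < ‖w‖
        rw [n1]
      simp only [Set.mem_inter_iff, mem_ball_iff_norm, sub_zero, n2, n1, h3]
    by_cases h : w ∈ Metric.ball 1 r ∩ {w | 1 - s < ‖w‖} ∩ Metric.ball 0 1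
    · rw [Set.indicator_of_mem h, Set.indicator_of_mem (hiff.2 h), weight, weight, n1]
    · rw [Set.indicator_of_notMem h, Set.indicator_of_notMem (fun h' => h (hiff.1 h'))]
  simp only [e1]
  rw [lintegral_polar 0 (hwm.indicator ((hE 1).inter hD))]
  have hk : 0 ≤ (1 + α) * 2 ^ |α| := by positivity
  have e2 : ∀ ρ ∈ Set.Ioi (0 : ℝ), ∀ θ ∈ Set.Ioo (-π) π,
      ENNReal.ofReal ρ * (Metric.ball 1 r ∩ {w | 1 - s < ‖w‖} ∩ Metric.ball 0 1).indicator
        (fun z => ENNReal.ofReal (weight α z)) (circleMap 0 ρ θ) ≤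
      (Set.Ioo (1 - s) 1).indicator
        (fun ρ => ENNReal.ofReal ((1 + α) * 2 ^ |α|) * ENNReal.ofReal ((1 - ρ) ^ α)) ρ *
        (Set.Ioo (-(π * r)) (π * r)).indicator 1 θ := by
    intro ρ hρ θ hθ
    rw [Set.mem_Ioi] at hρ
    by_cases h : circleMap 0 ρ θ ∈ Metric.ball 1 r ∩ {w | 1 - s < ‖w‖} ∩ Metric.ball 0 1
    · rw [Set.indicator_of_mem h]
      obtain ⟨⟨h1, h2⟩, h3⟩ := h
      have hn : ‖circleMap 0 ρ θ‖ = ρ := by rw [norm_circleMap_zero, abs_of_pos hρ]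
      change 1 - s < ‖circleMap 0 ρ θ‖ at h2
      rw [mem_ball_iff_norm] at h1
      rw [mem_ball_zero_iff] at h3
      have h4 := weight_le hα h3
      rw [hn] at h2 h3 h4
      have h5 : |θ| < π * r := (abs_le_pi_mul_norm_circleMap_sub_one hρ h3 hθ).trans_lt
        (mul_lt_mul_of_pos_left h1 Real.pi_pos)
      rw [Set.indicator_of_mem (Set.mem_Ioo.2 ⟨h2, h3⟩),
        Set.indicator_of_mem (Set.mem_Ioo.2 (abs_lt.1 h5)), Pi.one_apply, mul_one,
        ← ENNReal.ofReal_mul hk]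
      refine (mul_le_of_le_one_left zero_le (ENNReal.ofReal_le_one.2 h3.le)).trans ?_
      refine ENNReal.ofReal_le_ofReal ?_
      linarith
    · rw [Set.indicator_of_notMem h, mul_zero]
      exact zero_le
  calc _ ≤ (ENNReal.ofReal π)⁻¹ * ∫⁻ ρ in Set.Ioi (0 : ℝ), ∫⁻ θ in Set.Ioo (-π) π,
          (Set.Ioo (1 - s) 1).indicator
            (fun ρ => ENNReal.ofReal ((1 + α) * 2 ^ |α|) * ENNReal.ofReal ((1 - ρ) ^ α)) ρ *
            (Set.Ioo (-(π * r)) (π * r)).indicator 1 θ := by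
        refine mul_le_mul' le_rfl ?_
        exact setLIntegral_mono' measurableSet_Ioi fun ρ hρ =>
          setLIntegral_mono' measurableSet_Ioo fun θ hθ => e2 ρ hρ θ hθ
    _ ≤ (ENNReal.ofReal π)⁻¹ * ∫⁻ ρ, ∫⁻ θ, (Set.Ioo (1 - s) 1).indicator
            (fun ρ => ENNReal.ofReal ((1 + α) * 2 ^ |α|) * ENNReal.ofReal ((1 - ρ) ^ α)) ρ *
            (Set.Ioo (-(π * r)) (π * r)).indicator 1 θ := by
        refine mul_le_mul' le_rfl ?_
        exact (setLIntegral_le_lintegral _ _).trans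
          (lintegral_mono fun ρ => setLIntegral_le_lintegral _ _)
    _ = (ENNReal.ofReal π)⁻¹ * (ENNReal.ofReal ((1 + α) * 2 ^ |α|) *
          ENNReal.ofReal (s ^ (1 + α) / (1 + α)) * ENNReal.ofReal (π * r - -(π * r))) := by
        have e3 : ∀ ρ : ℝ, ∫⁻ θ : ℝ, (Set.Ioo (1 - s) 1).indicator
            (fun ρ => ENNReal.ofReal ((1 + α) * 2 ^ |α|) * ENNReal.ofReal ((1 - ρ) ^ α)) ρ *
            (Set.Ioo (-(π * r)) (π * r)).indicator 1 θ = (Set.Ioo (1 - s) 1).indicator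
            (fun ρ => ENNReal.ofReal ((1 + α) * 2 ^ |α|) * ENNReal.ofReal ((1 - ρ) ^ α)) ρ *
            ENNReal.ofReal (π * r - -(π * r)) := fun ρ => by
          rw [lintegral_const_mul _ (measurable_one.indicator measurableSet_Ioo),
            lintegral_indicator_one measurableSet_Ioo, Real.volume_Ioo]
        simp only [e3]
        rw [lintegral_mul_const' _ _ ENNReal.ofReal_ne_top, lintegral_indicator measurableSet_Ioo,
          lintegral_const_mul' _ _ ENNReal.ofReal_ne_top, lintegral_rpow_one_sub hα hs]
    _ = _ := by
        rw [← ENNReal.ofReal_mul hk, ← ENNReal.ofReal_mul (by positivity),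
          ← ENNReal.ofReal_inv_of_pos Real.pi_pos, ← ENNReal.ofReal_mul (by positivity)]
        congr 1
        field_simp
        ring

theorem weightedArea_ball_le {α : ℝ} (hα : -1 < α) {ζ : ℂ} (hζ : ‖ζ‖ = 1) {r : ℝ} (hr : 0 < r) :
    weightedArea α (Metric.ball ζ r) ≤ ENNReal.ofReal (2 * 2 ^ |α| * r ^ (2 + α)) := by
  have h1 : Metric.ball ζ r ⊆ Metric.ball ζ r ∩ {w | 1 - r < ‖w‖} := fun w hw => by
    refine ⟨hw, ?_⟩
    rw [mem_ball_iff_norm] at hw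
    change 1 - r < ‖w‖
    have := norm_sub_norm_le ζ w
    rw [norm_sub_rev] at this
    linarith
  refine (measure_mono h1).trans ((weightedArea_strip_le hα hζ hr hr).trans_eq ?_)
  rw [mul_assoc _ r, show 2 + α = 1 + (1 + α) by ring, Real.rpow_add hr 1 (1 + α), Real.rpow_one]

/-- Since `ω_α(B(ζ, r))` is at most of order `r ^ (2 + α)`, a dyadic decomposition bounds the
integral of `|w - ζ| ^ (-2 (2 + α))` off `B(ζ, s)`. -/
theorem exists_lintegral_compl_ball_le {α : ℝ} (hα : -1 < α) :
    ∃ C : ℝ, 0 < C ∧ ∀ ζ : ℂ, ‖ζ‖ = 1 → ∀ s : ℝ, 0 < s →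
      ∫⁻ w in (Metric.ball ζ s)ᶜ, ENNReal.ofReal (‖w - ζ‖ ^ (-(2 * (2 + α)))) ∂weightedArea α
        ≤ ENNReal.ofReal (C * s ^ (-(2 + α))) := by
  set b : ℝ := 2 + α with hb
  have hb0 : 0 < b := by linarith
  set q : ℝ := (2 : ℝ) ^ (-b) with hq
  have hq0 : 0 < q := by positivity
  have hq1 : q < 1 := Real.rpow_lt_one_of_one_lt_of_neg one_lt_two (by linarith)
  set A : ℝ := 2 * 2 ^ |α| * 2 ^ b with hA
  have hA0 : 0 < A := by positivity
  refine ⟨A * (1 - q)⁻¹, mul_pos hA0 (inv_pos.2 (by linarith)), fun ζ hζ s hs => ?_⟩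
  set T : ℕ → Set ℂ := fun k => {w | 2 ^ k * s ≤ ‖w - ζ‖} ∩ Metric.ball ζ (2 ^ (k + 1) * s) with hT
  have hTm : ∀ k, MeasurableSet (T k) := fun k =>
    (measurableSet_le measurable_const (by fun_prop)).inter Metric.isOpen_ball.measurableSet
  have hcov : (Metric.ball ζ s)ᶜ ⊆ ⋃ k, T k := by
    intro w hw
    have hw' : s ≤ ‖w - ζ‖ := by
      by_contra h
      exact hw (mem_ball_iff_norm.2 (not_le.1 h))
    obtain ⟨k, hk1, hk2⟩ := exists_nat_pow_near (x := ‖w - ζ‖ / s)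
      ((one_le_div hs).2 hw') one_lt_two
    rw [Set.mem_iUnion]
    exact ⟨k, (le_div_iff₀ hs).1 hk1, mem_ball_iff_norm.2 ((div_lt_iff₀ hs).1 hk2)⟩
  have hterm : ∀ k, ∫⁻ w in T k, ENNReal.ofReal (‖w - ζ‖ ^ (-(2 * b))) ∂weightedArea α ≤
      ENNReal.ofReal (A * s ^ (-b) * q ^ k) := by
    intro k
    have hks : 0 < 2 ^ k * s := by positivity
    calc _ ≤ ∫⁻ _w in T k, ENNReal.ofReal ((2 ^ k * s) ^ (-(2 * b))) ∂weightedArea α := by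
          refine setLIntegral_mono' (hTm k) fun w hw => ENNReal.ofReal_le_ofReal ?_
          exact Real.rpow_le_rpow_of_nonpos hks hw.1 (by linarith)
      _ ≤ ENNReal.ofReal ((2 ^ k * s) ^ (-(2 * b))) *
            ENNReal.ofReal (2 * 2 ^ |α| * (2 ^ (k + 1) * s) ^ b) := by
          rw [setLIntegral_const]
          gcongr
          exact (measure_mono Set.inter_subset_right).trans
            (weightedArea_ball_le hα hζ (by positivity))
      _ = _ := by
          rw [← ENNReal.ofReal_mul (by positivity)]
          congr 1
          have e1 : (2 : ℝ) ^ (k + 1) * s = 2 * (2 ^ k * s) := by ring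
          have e2 : (2 ^ k * s : ℝ) ^ (-(2 * b)) = (2 ^ k * s) ^ (-b) * ((2 ^ k * s) ^ b)⁻¹ := by
            rw [← Real.rpow_neg hks.le, ← Real.rpow_add hks]; congr 1; ring
          have e3 : (2 ^ k * s : ℝ) ^ (-b) = q ^ k * s ^ (-b) := by
            rw [Real.mul_rpow (by positivity) hs.le, hq, ← Real.rpow_natCast, ← Real.rpow_natCast,
              ← Real.rpow_mul zero_le_two, ← Real.rpow_mul zero_le_two, mul_comm (k : ℝ)]
          rw [e1, Real.mul_rpow zero_le_two hks.le, e2, e3, hA]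
          have : ((2 ^ k * s : ℝ) ^ b) ≠ 0 := by positivity
          field_simp
  calc _ ≤ ∫⁻ w in ⋃ k, T k, ENNReal.ofReal (‖w - ζ‖ ^ (-(2 * b))) ∂weightedArea α :=
        lintegral_mono_set hcov
    _ ≤ ∑' k, ∫⁻ w in T k, ENNReal.ofReal (‖w - ζ‖ ^ (-(2 * b))) ∂weightedArea α :=
        lintegral_iUnion_le _ _
    _ ≤ ∑' k, ENNReal.ofReal (A * s ^ (-b) * q ^ k) := ENNReal.tsum_le_tsum hterm
    _ = _ := by
        rw [← ENNReal.ofReal_tsum_of_nonneg (fun k => by positivity)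
          ((summable_geometric_of_lt_one hq0.le hq1).mul_left _), tsum_mul_left,
          tsum_geometric_of_lt_one hq0.le hq1]
        congr 1; ring

/-! ### The reproducing kernel -/

theorem norm_kernel_sq (α : ℝ) (z w : ℂ) :
    ‖kernel α z w‖ ^ 2 = ‖1 - (starRingEnd ℂ) z * w‖ ^ (-(2 * (2 + α))) := by
  rw [kernel, norm_div, norm_one, Complex.norm_cpow_real, one_div, ← Real.rpow_neg (norm_nonneg _),
    ← Real.rpow_natCast, ← Real.rpow_mul (norm_nonneg _)]
  congr 1
  push_cast
  ring

theorem enorm_kernel_sq (α : ℝ) (z w : ℂ) :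
    ‖kernel α z w‖ₑ ^ 2 =
      ENNReal.ofReal (‖1 - (starRingEnd ℂ) z * w‖ ^ (-(2 * (2 + α)))) := by
  rw [← norm_kernel_sq, ENNReal.ofReal_pow (norm_nonneg _), ofReal_norm]

theorem measurable_kernel (α : ℝ) : Measurable fun p : ℂ × ℂ => kernel α p.1 p.2 := by
  unfold kernel
  have h1 : Measurable fun p : ℂ × ℂ => 1 - (starRingEnd ℂ) p.1 * p.2 :=
    (continuous_const.sub ((Complex.continuous_conj.comp continuous_fst).mul
      continuous_snd)).measurable
  exact measurable_const.div (h1.pow_const _)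

theorem one_sub_norm_le_norm_one_sub {z w : ℂ} (hw : ‖w‖ < 1) :
    1 - ‖z‖ ≤ ‖1 - (starRingEnd ℂ) z * w‖ := by
  have h1 := norm_sub_norm_le (1 : ℂ) ((starRingEnd ℂ) z * w)
  rw [norm_one, norm_mul, Complex.norm_conj] at h1
  nlinarith [norm_nonneg z, norm_nonneg w]

/-- The lower estimate for the norm of the reproducing kernel, obtained by integrating over the disc
`B(z, (1 - |z|) / 2)`, on which all quantities are almost constant. -/
theorem exists_le_lintegral_kernel {α : ℝ} (hα : -1 < α) :
    ∃ c : ℝ, 0 < c ∧ ∀ z : ℂ, ‖z‖ < 1 → ENNReal.ofReal (c * (1 - ‖z‖) ^ (-(2 + α))) ≤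
      ∫⁻ w, ‖kernel α z w‖ₑ ^ 2 ∂weightedArea α := by
  have hα1 : 0 < 1 + α := by linarith
  set m : ℝ := 3 ^ (-(2 * (2 + α))) * ((1 + α) / (2 ^ |α| * (16 * 8 ^ |α|))) with hm
  have hm0 : 0 < m := by positivity
  refine ⟨m / 4, by positivity, fun z hz => ?_⟩
  set R := 1 - ‖z‖ with hR
  have hR0 : 0 < R := by linarith
  have hzn := norm_nonneg z
  have hB : MeasurableSet (Metric.ball z (R / 2)) := Metric.isOpen_ball.measurableSet
  have hD : MeasurableSet (Metric.ball (0 : ℂ) 1) := Metric.isOpen_ball.measurableSet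
  have hBD : Metric.ball z (R / 2) ⊆ Metric.ball 0 1 := by
    refine Metric.ball_subset_ball' ?_
    rw [dist_zero_right]; linarith
  have hpt : ∀ w ∈ Metric.ball z (R / 2), m * R ^ (-(2 * (2 + α))) * R ^ α ≤
      weight α w * ‖1 - (starRingEnd ℂ) z * w‖ ^ (-(2 * (2 + α))) := by
    intro w hw
    have hw1 := mem_ball_zero_iff.1 (hBD hw)
    rw [mem_ball_iff_norm] at hw
    have k1 : (3 * R) ^ (-(2 * (2 + α))) ≤ ‖1 - (starRingEnd ℂ) z * w‖ ^ (-(2 * (2 + α))) := by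
      refine Real.rpow_le_rpow_of_nonpos ?_ ?_ (by linarith)
      · exact hR0.trans_le (one_sub_norm_le_norm_one_sub hw1)
      · have e1 : 1 - (starRingEnd ℂ) z * w = ((1 - ‖z‖ ^ 2 : ℝ) : ℂ) -
            (starRingEnd ℂ) z * (w - z) := by
          have : (starRingEnd ℂ) z * z = ((‖z‖ ^ 2 : ℝ) : ℂ) := by
            rw [mul_comm, Complex.mul_conj, Complex.normSq_eq_norm_sq]
          rw [Complex.ofReal_sub, ← this, Complex.ofReal_one]; ring
        have h2 := norm_sub_le ((1 - ‖z‖ ^ 2 : ℝ) : ℂ) ((starRingEnd ℂ) z * (w - z))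
        rw [← e1, Complex.norm_real, Real.norm_eq_abs, abs_of_nonneg (by nlinarith), norm_mul,
          Complex.norm_conj] at h2
        nlinarith [norm_nonneg (w - z)]
    have k2 := weight_div_le hα (κ := 1 / 2) (by norm_num) (by norm_num) hz
      (z := w) (by rw [← hR]; linarith)
    have k3 := le_weight hα hz
    rw [← hR] at k2 k3
    have h3 : R / 2 ≤ 1 - ‖w‖ := by
      have := abs_le.1 (abs_norm_sub_norm_le w z)
      linarith
    have h4 : 0 < weight α w := weight_pos hα (mem_ball_zero_iff.2 hw1)
    have k4 : weight α z ≤ 16 * 8 ^ |α| * weight α w := by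
      have e8 : (4 / (1 - 1 / 2) : ℝ) = 8 := by norm_num
      rw [e8, mul_div_assoc', div_le_div_iff₀ (by positivity) (pow_pos (by linarith) 2)] at k2
      have h8 : (0 : ℝ) < 8 ^ |α| := by positivity
      have h5 : (R / 2) ^ 2 ≤ (1 - ‖w‖) ^ 2 := by gcongr
      have h6 : weight α z * (R / 2) ^ 2 ≤ 4 * 8 ^ |α| * weight α w * R ^ 2 :=
        (mul_le_mul_of_nonneg_left h5
          (weight_pos hα (mem_ball_zero_iff.2 hz)).le).trans k2
      have h7 : 0 < R ^ 2 := by positivity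
      refine le_of_mul_le_mul_right ?_ h7
      linarith
    have k5 : (1 + α) / (2 ^ |α| * (16 * 8 ^ |α|)) * R ^ α ≤ weight α w := by
      rw [div_mul_eq_mul_div, div_le_iff₀ (by positivity)]
      calc (1 + α) * R ^ α ≤ 2 ^ |α| * weight α z := k3
        _ ≤ 2 ^ |α| * (16 * 8 ^ |α| * weight α w) := by gcongr
        _ = _ := by ring
    calc m * R ^ (-(2 * (2 + α))) * R ^ α
        = ((1 + α) / (2 ^ |α| * (16 * 8 ^ |α|)) * R ^ α) * (3 * R) ^ (-(2 * (2 + α))) := by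
          rw [hm, Real.mul_rpow (by norm_num) hR0.le]; ring
      _ ≤ _ := by gcongr
  rw [lintegral_weightedArea]
  calc ENNReal.ofReal (m / 4 * R ^ (-(2 + α)))
      = (ENNReal.ofReal π)⁻¹ * (ENNReal.ofReal (m * R ^ (-(2 * (2 + α))) * R ^ α) *
          volume (Metric.ball z (R / 2))) := by
        rw [volume_ball_eq z (by positivity), ← ENNReal.ofReal_mul (by positivity),
          ← ENNReal.ofReal_inv_of_pos Real.pi_pos, ← ENNReal.ofReal_mul (by positivity)]
        congr 1
        have e1 : R ^ (-(2 + α)) = R ^ (-(2 * (2 + α))) * R ^ α * R ^ 2 := by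
          rw [← Real.rpow_natCast R 2, ← Real.rpow_add hR0, ← Real.rpow_add hR0]
          congr 1; push_cast; ring
        rw [e1]
        field_simp
        norm_num
    _ = (ENNReal.ofReal π)⁻¹ * ∫⁻ _w in Metric.ball z (R / 2),
          ENNReal.ofReal (m * R ^ (-(2 * (2 + α))) * R ^ α) := by rw [setLIntegral_const]
    _ ≤ (ENNReal.ofReal π)⁻¹ * ∫⁻ w in Metric.ball z (R / 2),
          ENNReal.ofReal (weight α w) * ‖kernel α z w‖ₑ ^ 2 := by
        refine mul_le_mul' le_rfl (setLIntegral_mono' hB fun w hw => ?_)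
        rw [enorm_kernel_sq, ← ENNReal.ofReal_mul (weight_pos hα (hBD hw)).le]
        exact ENNReal.ofReal_le_ofReal (hpt w hw)
    _ ≤ _ := mul_le_mul' le_rfl (lintegral_mono_set hBD)

/-! ### Kernel mass implies density -/

theorem le_of_ofReal_le_ofReal_mul_add {A B T : ℝ} {m : ℝ≥0∞} (hB : 0 ≤ B) (hT : 0 ≤ T)
    (hm : m ≠ ∞) (h : ENNReal.ofReal A ≤ ENNReal.ofReal B * m + ENNReal.ofReal T) :
    A ≤ B * m.toReal + T := by
  have hm0 : 0 ≤ m.toReal := ENNReal.toReal_nonneg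
  rw [← ENNReal.ofReal_toReal hm, ← ENNReal.ofReal_mul hB, ← ENNReal.ofReal_add (by positivity) hT,
    ENNReal.ofReal_le_ofReal_iff (by positivity)] at h
  exact h

/-- If `G` carries a fixed proportion of the mass of the normalized reproducing kernels, then it
carries a fixed proportion of the `ω_α`-area of every boundary disc: the kernel at a point at
distance `t / M` from the centre of the disc has most of its mass there. -/
theorem exists_le_weightedArea_inter_ball {α : ℝ} (hα : -1 < α) {G : Set ℂ} {c : ℝ} (hc : 0 < c)
    (h : ∀ᵐ z ∂diskArea, ENNReal.ofReal c * ∫⁻ w, ‖kernel α z w‖ₑ ^ 2 ∂weightedArea α ≤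
      ∫⁻ w in G, ‖kernel α z w‖ₑ ^ 2 ∂weightedArea α) :
    ∃ c' : ℝ, 0 < c' ∧ ∀ (ζ : ℂ) (t : ℝ), ‖ζ‖ = 1 → 0 < t → t ≤ 1 →
      c' * t ^ (2 + α) ≤ (weightedArea α).real (G ∩ Metric.ball ζ t) := by
  obtain ⟨c₁, hc₁, hlow⟩ := exists_le_lintegral_kernel hα
  obtain ⟨C, hC, htail⟩ := exists_lintegral_compl_ball_le hα
  set b : ℝ := 2 + α with hb
  have hb0 : 0 < b := by linarith
  -- `M` makes the tail at most half of the total kernel mass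
  obtain ⟨M, hM4, hM⟩ := ((eventually_ge_atTop (4 : ℝ)).and
    ((tendsto_rpow_atTop hb0).eventually_ge_atTop
      (2 * (2 ^ (2 * b) * C) / (c * c₁ * 2 ^ (-b))))).exists
  have hM0 : 0 < M := by linarith
  rw [div_le_iff₀ (by positivity)] at hM
  refine ⟨c * c₁ * 2 ^ (-b) * M ^ b / 2 / (2 * M) ^ (2 * b), by positivity,
    fun ζ t hζ ht ht1 => ?_⟩
  set k := t / M with hk
  have hk0 : 0 < k := by positivity
  have htM : t = M * k := by rw [hk]; field_simp
  have hk4 : 4 * k ≤ t := by rw [htM]; gcongr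
  -- a point of the exceptional null set may lie at `(1 - k) ζ`, hence the choice of `z` nearby
  set a : ℂ := ((1 - k : ℝ) : ℂ) * ζ with ha
  have hna : ‖a‖ = 1 - k := by
    rw [ha, norm_mul, hζ, mul_one, Complex.norm_real, Real.norm_eq_abs, abs_of_nonneg (by linarith)]
  have hUD : Metric.ball a (k / 2) ⊆ Metric.ball 0 1 := by
    refine Metric.ball_subset_ball' ?_
    rw [dist_zero_right, hna]; linarith
  have hU : diskArea (Metric.ball a (k / 2)) ≠ 0 := by
    rw [diskArea_apply Metric.isOpen_ball.measurableSet, Set.inter_eq_left.2 hUD,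
      volume_ball_eq a (by positivity)]
    refine mul_ne_zero (by simp) ?_
    simp only [ne_eq, ENNReal.ofReal_eq_zero, not_le]
    positivity
  obtain ⟨z, hzU, hz⟩ := ((frequently_ae_mem_iff.2 hU).and_eventually h).exists
  have hz1 := mem_ball_zero_iff.1 (hUD hzU)
  rw [mem_ball_iff_norm] at hzU
  have hzlow : k / 2 ≤ 1 - ‖z‖ := by
    have := norm_le_norm_add_norm_sub' z a
    linarith
  have hzζ : ‖ζ - z‖ ≤ 2 * k := by
    have h1 : ‖ζ - a‖ = k := by
      have : ζ - a = (k : ℂ) * ζ := by rw [ha]; push_cast; ring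
      rw [this, norm_mul, hζ, mul_one, Complex.norm_real, Real.norm_eq_abs, abs_of_pos hk0]
    have h2 := norm_sub_le_norm_sub_add_norm_sub ζ a z
    rw [norm_sub_rev a z] at h2
    linarith
  have hzup : 1 - ‖z‖ ≤ 2 * k := by
    have := norm_sub_norm_le ζ z
    linarith
  have hB : MeasurableSet (Metric.ball ζ t) := Metric.isOpen_ball.measurableSet
  have hae : ∀ᵐ w ∂weightedArea α, ‖w‖ < 1 :=
    (weightedArea_absolutelyContinuous α).ae_le
      (ae_mem_ball_diskArea.mono fun w hw => mem_ball_zero_iff.1 hw)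
  have hfin : weightedArea α (G ∩ Metric.ball ζ t) ≠ ∞ :=
    ne_top_of_le_ne_top ENNReal.ofReal_ne_top
      ((measure_mono Set.inter_subset_right).trans (weightedArea_ball_le hα hζ ht))
  have hnear : ∫⁻ w in G ∩ Metric.ball ζ t, ‖kernel α z w‖ₑ ^ 2 ∂weightedArea α ≤
      ENNReal.ofReal ((k / 2) ^ (-(2 * b))) * weightedArea α (G ∩ Metric.ball ζ t) := by
    rw [← setLIntegral_const]
    refine lintegral_mono_ae (ae_restrict_of_ae (hae.mono fun w hw => ?_))
    rw [enorm_kernel_sq]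
    refine ENNReal.ofReal_le_ofReal (Real.rpow_le_rpow_of_nonpos (by positivity) ?_ (by linarith))
    exact hzlow.trans (one_sub_norm_le_norm_one_sub hw)
  have hfar : ∫⁻ w in (Metric.ball ζ t)ᶜ, ‖kernel α z w‖ₑ ^ 2 ∂weightedArea α ≤
      ENNReal.ofReal (2 ^ (2 * b) * C * t ^ (-b)) := by
    have h1 : ∫⁻ w in (Metric.ball ζ t)ᶜ, ‖kernel α z w‖ₑ ^ 2 ∂weightedArea α ≤
        ∫⁻ w in (Metric.ball ζ t)ᶜ, ENNReal.ofReal (2 ^ (2 * b)) *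
          ENNReal.ofReal (‖w - ζ‖ ^ (-(2 * b))) ∂weightedArea α := by
      refine lintegral_mono_ae ?_
      filter_upwards [ae_restrict_of_ae hae, ae_restrict_mem hB.compl] with w hw hwB
      have hwt : t ≤ ‖w - ζ‖ := by
        by_contra h
        exact hwB (mem_ball_iff_norm.2 (not_le.1 h))
      rw [enorm_kernel_sq, ← ENNReal.ofReal_mul (by positivity)]
      refine ENNReal.ofReal_le_ofReal ?_
      have h2 : ‖w - ζ‖ / 2 ≤ ‖1 - (starRingEnd ℂ) z * w‖ := by
        have e1 : 1 - (starRingEnd ℂ) z * w =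
            (starRingEnd ℂ) ζ * (ζ - w) + (starRingEnd ℂ) (ζ - z) * w := by
          have : (starRingEnd ℂ) ζ * ζ = 1 := by
            rw [mul_comm, Complex.mul_conj, Complex.normSq_eq_norm_sq, hζ]; simp
          rw [mul_sub, this, map_sub]; ring
        have h3 : ‖(starRingEnd ℂ) ζ * (ζ - w)‖ = ‖w - ζ‖ := by
          rw [norm_mul, Complex.norm_conj, hζ, one_mul, norm_sub_rev]
        have h4 : ‖(starRingEnd ℂ) (ζ - z) * w‖ ≤ 2 * k := by
          rw [norm_mul, Complex.norm_conj]
          nlinarith [norm_nonneg (ζ - z), norm_nonneg w]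
        have h5 := norm_sub_le_norm_add ((starRingEnd ℂ) ζ * (ζ - w))
          ((starRingEnd ℂ) (ζ - z) * w)
        rw [← e1, h3] at h5
        linarith
      have h6 : 0 < ‖w - ζ‖ := ht.trans_le hwt
      calc ‖1 - (starRingEnd ℂ) z * w‖ ^ (-(2 * b)) ≤ (‖w - ζ‖ / 2) ^ (-(2 * b)) :=
            Real.rpow_le_rpow_of_nonpos (by positivity) h2 (by linarith)
        _ = 2 ^ (2 * b) * ‖w - ζ‖ ^ (-(2 * b)) := by
            rw [Real.div_rpow h6.le zero_le_two, Real.rpow_neg zero_le_two, div_inv_eq_mul,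
              mul_comm]
    refine h1.trans ?_
    rw [lintegral_const_mul' _ _ ENNReal.ofReal_ne_top, mul_assoc,
      ENNReal.ofReal_mul (by positivity)]
    exact mul_le_mul' le_rfl (htail ζ hζ t ht)
  have hsplit : ∫⁻ w in G, ‖kernel α z w‖ₑ ^ 2 ∂weightedArea α ≤
      (∫⁻ w in G ∩ Metric.ball ζ t, ‖kernel α z w‖ₑ ^ 2 ∂weightedArea α) +
        ∫⁻ w in (Metric.ball ζ t)ᶜ, ‖kernel α z w‖ₑ ^ 2 ∂weightedArea α := by
    refine (lintegral_mono_set fun w hw => ?_).trans (lintegral_union_le _ _ _)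
    by_cases hwB : w ∈ Metric.ball ζ t
    · exact Or.inl ⟨hw, hwB⟩
    · exact Or.inr hwB
  have hmain : ENNReal.ofReal (c * (c₁ * (2 * k) ^ (-b))) ≤
      ENNReal.ofReal ((k / 2) ^ (-(2 * b))) * weightedArea α (G ∩ Metric.ball ζ t) +
        ENNReal.ofReal (2 ^ (2 * b) * C * t ^ (-b)) := by
    refine le_trans ?_ (hz.trans (hsplit.trans (add_le_add hnear hfar)))
    rw [ENNReal.ofReal_mul hc.le]
    refine mul_le_mul' le_rfl (le_trans (ENNReal.ofReal_le_ofReal ?_) (hlow z hz1))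
    refine mul_le_mul_of_nonneg_left ?_ hc₁.le
    exact Real.rpow_le_rpow_of_nonpos (by linarith) hzup (by linarith)
  have hreal := le_of_ofReal_le_ofReal_mul_add (by positivity) (by positivity) hfin hmain
  rw [← measureReal_def] at hreal
  set V := (weightedArea α).real (G ∩ Metric.ball ζ t)
  have e1 : (2 * k) ^ (-b) = 2 ^ (-b) * M ^ b * t ^ (-b) := by
    rw [hk, Real.mul_rpow zero_le_two hk0.le, Real.div_rpow ht.le hM0.le,
      Real.rpow_neg hM0.le, div_inv_eq_mul]
    ring
  have e2 : (k / 2) ^ (-(2 * b)) = (2 * M) ^ (2 * b) * t ^ (-(2 * b)) := by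
    have : k / 2 = t / (2 * M) := by rw [hk]; field_simp
    rw [this, Real.div_rpow ht.le (by positivity), Real.rpow_neg (by positivity : 0 ≤ 2 * M),
      div_inv_eq_mul, mul_comm]
  have e3 : t ^ (-(2 * b)) = t ^ (-b) * (t ^ b)⁻¹ := by
    rw [← Real.rpow_neg ht.le, ← Real.rpow_add ht]; congr 1; ring
  rw [e1, e2, e3] at hreal
  have hT : 0 < t ^ (-b) := by positivity
  have hTb : 0 < t ^ b := by positivity
  have h9 : c * c₁ * 2 ^ (-b) * M ^ b / 2 ≤ (2 * M) ^ (2 * b) * (t ^ b)⁻¹ * V := by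
    refine le_of_mul_le_mul_right ?_ hT
    have h10 := mul_le_mul_of_nonneg_right hM hT.le
    linarith
  rw [div_mul_eq_mul_div, div_le_iff₀ (by positivity)]
  calc c * c₁ * 2 ^ (-b) * M ^ b / 2 * t ^ b
      ≤ (2 * M) ^ (2 * b) * (t ^ b)⁻¹ * V * t ^ b := by gcongr
    _ = _ := by field_simp

/-- A lower bound for the `ω_α`-area of `G ∩ B(ζ, t)` gives one for its area, once a thin strip along
the unit circle, where `ω_α` may be large, is removed. -/
theorem isBoundaryDense_of_le_weightedArea {α : ℝ} (hα : -1 < α) {G : Set ℂ} (hG : MeasurableSet G)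
    {c : ℝ} (hc : 0 < c) (h : ∀ (ζ : ℂ) (t : ℝ), ‖ζ‖ = 1 → 0 < t → t ≤ 1 →
      c * t ^ (2 + α) ≤ (weightedArea α).real (G ∩ Metric.ball ζ t)) : IsBoundaryDense G := by
  have hα1 : 0 < 1 + α := by linarith
  set C : ℝ := 2 * 2 ^ |α| with hC
  have hC0 : 0 < C := by positivity
  -- the strip of width `ε t` takes at most half of the `ω_α`-area of `G ∩ B(ζ, t)`
  set ε : ℝ := min 1 ((c / (2 * C)) ^ (1 + α)⁻¹) with hε
  have hε0 : 0 < ε := lt_min one_pos (by positivity)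
  have hε1 : ε ≤ 1 := min_le_left _ _
  have hεC : C * ε ^ (1 + α) ≤ c / 2 := by
    have : ε ^ (1 + α) ≤ c / (2 * C) := by
      calc ε ^ (1 + α) ≤ ((c / (2 * C)) ^ (1 + α)⁻¹) ^ (1 + α) :=
            Real.rpow_le_rpow hε0.le (min_le_right _ _) hα1.le
        _ = _ := Real.rpow_inv_rpow (by positivity) hα1.ne'
    calc C * ε ^ (1 + α) ≤ C * (c / (2 * C)) := by gcongr
      _ = c / 2 := by field_simp
  set K : ℝ := (1 + α) * (2 ^ |α| * (1 / ε) ^ |α|) with hK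
  have hK0 : 0 < K := by positivity
  have hmain : ∀ (ζ : ℂ) (t : ℝ), ‖ζ‖ = 1 → 0 < t → t ≤ 1 →
      c / (2 * K) * t ^ 2 ≤ diskArea.real (G ∩ Metric.ball ζ t) := by
    intro ζ t hζ ht ht1
    have hB : MeasurableSet (Metric.ball ζ t) := Metric.isOpen_ball.measurableSet
    have hS : MeasurableSet {w : ℂ | 1 - ε * t < ‖w‖} :=
      measurableSet_lt measurable_const (by fun_prop)
    have hfin : diskArea (G ∩ Metric.ball ζ t) ≠ ∞ := measure_ne_top _ _
    have h1 : weightedArea α ((G ∩ Metric.ball ζ t) \ {w | 1 - ε * t < ‖w‖}) ≤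
        ENNReal.ofReal (K * t ^ α) * diskArea (G ∩ Metric.ball ζ t) := by
      rw [weightedArea, withDensity_apply _ ((hG.inter hB).diff hS)]
      refine le_trans ?_ (mul_le_mul' le_rfl (measure_mono
        (Set.sdiff_subset (t := {w : ℂ | 1 - ε * t < ‖w‖}))))
      rw [← setLIntegral_const]
      refine lintegral_mono_ae ?_
      filter_upwards [ae_restrict_of_ae ae_mem_ball_diskArea,
        ae_restrict_mem ((hG.inter hB).diff hS)] with w hwD hw
      rw [mem_ball_zero_iff] at hwD
      have hw1 : ε * t ≤ 1 - ‖w‖ := by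
        have : ¬ (1 - ε * t < ‖w‖) := hw.2
        linarith
      have hw2 : 1 - ‖w‖ ≤ t := by
        have h3 := mem_ball_iff_norm.1 hw.1.2
        have h4 := norm_sub_norm_le ζ w
        rw [norm_sub_rev] at h4
        linarith
      have hw0 : 0 < 1 - ‖w‖ := by linarith
      refine ENNReal.ofReal_le_ofReal ((weight_le hα hwD).trans ?_)
      rw [hK, mul_assoc, mul_assoc]
      have hεinv : 1 ≤ 1 / ε := (one_le_div hε0).2 hε1
      gcongr
      refine rpow_le_rpow_of_comparable α hw0 ht ?_ ?_
      · exact hw2.trans (le_mul_of_one_le_left ht.le hεinv)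
      · rw [div_mul_eq_mul_div, one_mul, le_div_iff₀ hε0]; linarith
    have h2 : weightedArea α (G ∩ Metric.ball ζ t) ≤
        ENNReal.ofReal (K * t ^ α) * diskArea (G ∩ Metric.ball ζ t) +
          ENNReal.ofReal (C * t * (ε * t) ^ (1 + α)) := by
      refine le_trans (measure_mono fun w hw => ?_) ((measure_union_le _ _).trans
        (add_le_add h1 (weightedArea_strip_le hα hζ ht (mul_pos hε0 ht))))
      by_cases hwS : w ∈ {w : ℂ | 1 - ε * t < ‖w‖}
      · exact Or.inr ⟨hw.2, hwS⟩
      · exact Or.inl ⟨hw, hwS⟩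
    have h3 : ENNReal.ofReal (c * t ^ (2 + α)) ≤ weightedArea α (G ∩ Metric.ball ζ t) :=
      ENNReal.ofReal_le_of_le_toReal (h ζ t hζ ht ht1)
    have h4 := le_of_ofReal_le_ofReal_mul_add (by positivity) (by positivity) hfin (h3.trans h2)
    rw [← measureReal_def] at h4
    set V := diskArea.real (G ∩ Metric.ball ζ t)
    have ht0 : 0 < t ^ α := by positivity
    have e1 : t ^ (2 + α) = t ^ α * t ^ 2 := by
      rw [add_comm, Real.rpow_add ht, Real.rpow_two]
    have e2 : C * t * (ε * t) ^ (1 + α) = C * ε ^ (1 + α) * (t ^ α * t ^ 2) := by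
      rw [Real.mul_rpow hε0.le ht.le, Real.rpow_add ht 1 α, Real.rpow_one]; ring
    rw [e1, e2] at h4
    have h5 : C * ε ^ (1 + α) * (t ^ α * t ^ 2) ≤ c / 2 * (t ^ α * t ^ 2) := by gcongr
    rw [div_mul_eq_mul_div, div_le_iff₀ (by positivity)]
    refine le_of_mul_le_mul_right ?_ ht0
    nlinarith
  set δ : ℝ := min (1 / 2) (c / (2 * K)) with hδ
  have hδ0 : 0 < δ := lt_min (by norm_num) (by positivity)
  refine ⟨δ, hδ0, (min_le_left _ _).trans_lt (by norm_num), fun ζ t hζ ht => ?_⟩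
  -- discs of radius greater than `1` reduce to radius `1`, as the unit disc has area `1`
  have hs0 : 0 < min t 1 := lt_min ht one_pos
  have h1 := hmain ζ (min t 1) hζ hs0 (min_le_right _ _)
  have h2 : diskArea.real (G ∩ Metric.ball ζ (min t 1)) ≤
      diskArea.real (G ∩ Metric.ball ζ t) :=
    measureReal_mono (Set.inter_subset_inter_right _ (Metric.ball_subset_ball (min_le_left _ _)))
  have h3 : diskArea.real (Metric.ball 0 1 ∩ Metric.ball ζ t) ≤ min t 1 ^ 2 := by
    rcases le_total t 1 with ht1 | ht1
    · rw [min_eq_left ht1, diskArea_real_apply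
        (Metric.isOpen_ball.measurableSet.inter Metric.isOpen_ball.measurableSet),
        inv_mul_le_iff₀ Real.pi_pos, ← volume_real_ball_eq ζ ht.le]
      exact measureReal_mono (fun w hw => hw.1.2) measure_ball_lt_top.ne
    · rw [min_eq_right ht1, one_pow]
      exact measureReal_le_one
  calc δ * diskArea.real (Metric.ball 0 1 ∩ Metric.ball ζ t)
      ≤ c / (2 * K) * min t 1 ^ 2 := by
        gcongr
        exact min_le_right _ _
    _ ≤ _ := h1.trans h2

/-! ### Square integrable analytic functions -/

theorem isFiniteMeasure_weightedArea {α : ℝ} (hα : -1 < α) : IsFiniteMeasure (weightedArea α) := by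
  refine ⟨?_⟩
  have h1 : weightedArea α (Metric.ball (1 : ℂ) 3)ᶜ = 0 := by
    refine weightedArea_absolutelyContinuous α (measure_mono_null (fun w hw => ?_)
      (ae_iff.1 ae_mem_ball_diskArea))
    intro hwD
    refine hw (Metric.ball_subset_ball' ?_ hwD)
    norm_num
  have h2 := weightedArea_ball_le hα (norm_one : ‖(1 : ℂ)‖ = 1) (r := 3) (by norm_num)
  rw [← measure_add_measure_compl (Metric.isOpen_ball.measurableSet : MeasurableSet
    (Metric.ball (1 : ℂ) 3)), h1, add_zero]
  exact h2.trans_lt ENNReal.ofReal_lt_top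

theorem ae_norm_lt_one (α : ℝ) : ∀ᵐ w ∂weightedArea α, ‖w‖ < 1 :=
  (weightedArea_absolutelyContinuous α).ae_le
    (ae_mem_ball_diskArea.mono fun _ hw => mem_ball_zero_iff.1 hw)

theorem aestronglyMeasurable_of_differentiableOn (α : ℝ) {g : ℂ → ℂ}
    (hg : DifferentiableOn ℂ g (Metric.ball 0 1)) : AEStronglyMeasurable g (weightedArea α) := by
  refine ⟨_, (measurable_indicator_of_differentiableOn hg).stronglyMeasurable, ?_⟩
  filter_upwards [ae_norm_lt_one α] with w hw
  rw [Set.indicator_of_mem (mem_ball_zero_iff.2 hw)]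

theorem integral_norm_sq_eq_toReal {μ : Measure ℂ} {g : ℂ → ℂ} (hg : AEStronglyMeasurable g μ) :
    ∫ z, ‖g z‖ ^ 2 ∂μ = (∫⁻ z, ‖g z‖ₑ ^ 2 ∂μ).toReal := by
  have hm : AEStronglyMeasurable (fun z => ‖g z‖ ^ 2) μ := hg.norm.pow 2
  rw [integral_eq_lintegral_of_nonneg_ae (Eventually.of_forall fun z => by positivity) hm]
  congr 1
  refine lintegral_congr fun z => ?_
  rw [ENNReal.ofReal_pow (norm_nonneg _), ofReal_norm]

theorem memLp_two_iff_lintegral {μ : Measure ℂ} {g : ℂ → ℂ} (hg : AEStronglyMeasurable g μ) :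
    MemLp g 2 μ ↔ ∫⁻ z, ‖g z‖ₑ ^ 2 ∂μ ≠ ∞ := by
  rw [MemLp, and_iff_right hg, eLpNorm_lt_top_iff_lintegral_rpow_enorm_lt_top (by norm_num)
    (by norm_num), lt_top_iff_ne_top]
  simp

/-- The element of the Bergman space given by a square integrable analytic function. -/
theorem exists_bergmanSpace_eq {α : ℝ} {g : ℂ → ℂ} (hg : DifferentiableOn ℂ g (Metric.ball 0 1))
    (hfin : ∫⁻ z, ‖g z‖ₑ ^ 2 ∂weightedArea α ≠ ∞) :
    ∃ f : bergmanSpace α, (f : Lp ℂ 2 (weightedArea α)) =ᵐ[weightedArea α] g := by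
  have h := (memLp_two_iff_lintegral (aestronglyMeasurable_of_differentiableOn α hg)).2 hfin
  exact ⟨⟨h.toLp g, g, hg, h.coeFn_toLp⟩, h.coeFn_toLp⟩

/-- The reverse Carleson property in terms of square integrable analytic functions. -/
theorem isReverseCarleson_iff {α : ℝ} {G : Set ℂ} : IsReverseCarleson α G ↔
    ∃ C : ℝ, 0 < C ∧ ∀ g : ℂ → ℂ, DifferentiableOn ℂ g (Metric.ball 0 1) →
      ∫⁻ z, ‖g z‖ₑ ^ 2 ∂weightedArea α ≠ ∞ →
      ∫⁻ z, ‖g z‖ₑ ^ 2 ∂weightedArea α ≤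
        ENNReal.ofReal C * ∫⁻ z in G, ‖g z‖ₑ ^ 2 ∂weightedArea α := by
  refine exists_congr fun C => and_congr_right fun hC => ?_
  have key : ∀ (f : bergmanSpace α) (g : ℂ → ℂ), DifferentiableOn ℂ g (Metric.ball 0 1) →
      (f : Lp ℂ 2 (weightedArea α)) =ᵐ[weightedArea α] g →
      ((∫ z, ‖(f : Lp ℂ 2 (weightedArea α)) z‖ ^ 2 ∂weightedArea α
        ≤ C * ∫ z in G, ‖(f : Lp ℂ 2 (weightedArea α)) z‖ ^ 2 ∂weightedArea α) ↔
      ∫⁻ z, ‖g z‖ₑ ^ 2 ∂weightedArea α ≤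
        ENNReal.ofReal C * ∫⁻ z in G, ‖g z‖ₑ ^ 2 ∂weightedArea α) := by
    intro f g hg hfg
    have hgm := aestronglyMeasurable_of_differentiableOn α hg
    have hfin : ∫⁻ z, ‖g z‖ₑ ^ 2 ∂weightedArea α ≠ ∞ :=
      (memLp_two_iff_lintegral hgm).1 ((memLp_congr_ae hfg).1 (Lp.memLp _))
    have e1 : ∀ s : Set ℂ, ∫ z in s, ‖(f : Lp ℂ 2 (weightedArea α)) z‖ ^ 2 ∂weightedArea α =
        (∫⁻ z in s, ‖g z‖ₑ ^ 2 ∂weightedArea α).toReal := fun s => by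
      rw [← integral_norm_sq_eq_toReal hgm.restrict]
      refine integral_congr_ae (ae_restrict_of_ae ?_)
      filter_upwards [hfg] with z hz
      rw [hz]
    have e2 := e1 Set.univ
    rw [setLIntegral_univ, setIntegral_univ] at e2
    have hfinG : ∫⁻ z in G, ‖g z‖ₑ ^ 2 ∂weightedArea α ≠ ∞ :=
      ne_top_of_le_ne_top hfin (setLIntegral_le_lintegral _ _)
    rw [e2, e1, ← ENNReal.toReal_le_toReal hfin (by finiteness), ENNReal.toReal_mul,
      ENNReal.toReal_ofReal hC.le]
  constructor
  · intro h g hg hfin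
    obtain ⟨f, hf⟩ := exists_bergmanSpace_eq hg hfin
    exact (key f g hg hf).1 (h f)
  · intro h f
    obtain ⟨g, hg, hfg⟩ := f.2
    refine (key f g hg hfg).2 (h g hg ?_)
    exact (memLp_two_iff_lintegral (aestronglyMeasurable_of_differentiableOn α hg)).1
      ((memLp_congr_ae hfg).1 (Lp.memLp _))

theorem differentiableOn_kernel (α : ℝ) {z : ℂ} (hz : ‖z‖ < 1) :
    DifferentiableOn ℂ (kernel α z) (Metric.ball 0 1) := by
  intro w hw
  rw [mem_ball_zero_iff] at hw
  have h1 : ‖(starRingEnd ℂ) z * w‖ < 1 := by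
    rw [norm_mul, Complex.norm_conj]
    nlinarith [norm_nonneg z, norm_nonneg w]
  have h2 : 1 - (starRingEnd ℂ) z * w ∈ Complex.slitPlane := by
    refine Or.inl ?_
    have := (Complex.abs_re_le_norm ((starRingEnd ℂ) z * w)).trans_lt h1
    rw [Complex.sub_re, Complex.one_re]
    linarith [(abs_lt.1 this).2]
  have h3 : 1 - (starRingEnd ℂ) z * w ≠ 0 := Complex.slitPlane_ne_zero h2
  have h4 : DifferentiableAt ℂ (fun w => (1 - (starRingEnd ℂ) z * w) ^ ((2 + α : ℝ) : ℂ)) w :=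
    DifferentiableAt.cpow (by fun_prop) (by fun_prop) h2
  refine DifferentiableAt.differentiableWithinAt ?_
  unfold kernel
  refine (differentiableAt_const _).fun_div h4 ?_
  rw [Ne, Complex.cpow_eq_zero_iff]
  exact fun h => h3 h.1

theorem lintegral_kernel_ne_top {α : ℝ} (hα : -1 < α) {z : ℂ} (hz : ‖z‖ < 1) :
    ∫⁻ w, ‖kernel α z w‖ₑ ^ 2 ∂weightedArea α ≠ ∞ := by
  have := isFiniteMeasure_weightedArea hα
  have h1 : ∫⁻ w, ‖kernel α z w‖ₑ ^ 2 ∂weightedArea α ≤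
      ∫⁻ _w, ENNReal.ofReal ((1 - ‖z‖) ^ (-(2 * (2 + α)))) ∂weightedArea α := by
    refine lintegral_mono_ae ((ae_norm_lt_one α).mono fun w hw => ?_)
    rw [enorm_kernel_sq]
    exact ENNReal.ofReal_le_ofReal (Real.rpow_le_rpow_of_nonpos (by linarith)
      (one_sub_norm_le_norm_one_sub hw) (by linarith))
  refine ne_top_of_le_ne_top ?_ h1
  rw [lintegral_const]
  exact ENNReal.mul_ne_top ENNReal.ofReal_ne_top (measure_ne_top _ _)

theorem IsBoundaryDense.congr {G G' : Set ℂ} (h : G =ᵐ[diskArea] G') (hG : IsBoundaryDense G) :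
    IsBoundaryDense G' := by
  obtain ⟨δ, h0, h1, h2⟩ := hG
  refine ⟨δ, h0, h1, fun ζ t hζ ht => (h2 ζ t hζ ht).trans_eq ?_⟩
  exact measureReal_congr (h.inter (ae_eq_refl _))

/-- If `G` carries a fixed proportion of the mass of the reproducing kernels, then it satisfies the
boundary density condition. -/
theorem isBoundaryDense_of_kernel {α : ℝ} (hα : -1 < α) {G : Set ℂ}
    (hG : NullMeasurableSet G (weightedArea α)) {c : ℝ} (hc : 0 < c)
    (h : ∀ᵐ z ∂weightedArea α, ENNReal.ofReal c * ∫⁻ w, ‖kernel α z w‖ₑ ^ 2 ∂weightedArea α ≤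
      ∫⁻ w in G, ‖kernel α z w‖ₑ ^ 2 ∂weightedArea α) : IsBoundaryDense G := by
  obtain ⟨G', hG', hGG'⟩ := hG.exists_measurable_superset_ae_eq.imp fun _ h => h.2
  have h1 : ∀ᵐ z ∂diskArea, ENNReal.ofReal c * ∫⁻ w, ‖kernel α z w‖ₑ ^ 2 ∂weightedArea α ≤
      ∫⁻ w in G', ‖kernel α z w‖ₑ ^ 2 ∂weightedArea α := by
    refine (diskArea_absolutelyContinuous hα).ae_le (h.mono fun z hz => hz.trans_eq ?_)
    exact setLIntegral_congr hGG'.symm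
  obtain ⟨c', hc', h2⟩ := exists_le_weightedArea_inter_ball hα hc h1
  exact (isBoundaryDense_of_le_weightedArea hα hG' hc' h2).congr
    ((diskArea_absolutelyContinuous hα).ae_eq hGG')

/-- Luecking's theorem: reverse Carleson sets are those that are dense at the boundary. -/
theorem isReverseCarleson_iff_isBoundaryDense {α : ℝ} (hα : -1 < α) {G : Set ℂ}
    (hG : NullMeasurableSet G (weightedArea α)) : IsReverseCarleson α G ↔ IsBoundaryDense G := by
  constructor
  · intro h
    obtain ⟨C, hC, h⟩ := isReverseCarleson_iff.1 h
    refine isBoundaryDense_of_kernel hα hG (inv_pos.2 hC) ?_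
    filter_upwards [ae_norm_lt_one α] with z hz
    have h1 := h _ (differentiableOn_kernel α hz) (lintegral_kernel_ne_top hα hz)
    rwa [ENNReal.ofReal_inv_of_pos hC, ENNReal.inv_mul_le_iff (by simpa using hC)
      ENNReal.ofReal_ne_top]
  · intro h
    obtain ⟨G', hG', hGG'⟩ := hG.exists_measurable_superset_ae_eq.imp fun _ h => h.2
    obtain ⟨C, hC, h1⟩ := (h.congr
      ((diskArea_absolutelyContinuous hα).ae_eq hGG'.symm)).exists_lintegral_le hα hG'
    refine isReverseCarleson_iff.2 ⟨C, hC, fun g hg hfin => (h1 g hg hfin).trans_eq ?_⟩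
    rw [setLIntegral_congr hGG']

/-! ### The quadratic form, the Berezin transform and the Toeplitz operator of a symbol -/

section Symbol

variable {α : ℝ} {φ : ℂ → ℝ}

theorem nullMeasurableSet_levelSet (hφ : AEStronglyMeasurable φ (weightedArea α)) (r : ℝ) :
    NullMeasurableSet (levelSet φ r) (weightedArea α) :=
  Metric.isOpen_ball.measurableSet.nullMeasurableSet.inter
    (nullMeasurableSet_lt aemeasurable_const hφ.aemeasurable)

theorem ae_abs_le_of_memLp_top {μ : Measure ℂ} (hφ : MemLp φ ∞ μ) :
    ∃ M : ℝ, 0 < M ∧ ∀ᵐ z ∂μ, |φ z| ≤ M := by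
  have h1 : eLpNormEssSup φ μ ≠ ∞ := by
    have := hφ.2.ne
    rwa [eLpNorm_exponent_top] at this
  refine ⟨(eLpNormEssSup φ μ).toReal + 1, by positivity, ?_⟩
  filter_upwards [ae_le_eLpNormEssSup (f := φ) (μ := μ)] with z hz
  have h2 := ENNReal.toReal_mono h1 hz
  rw [toReal_enorm, Real.norm_eq_abs] at h2
  linarith

theorem integrable_norm_sq (f : Lp ℂ 2 (weightedArea α)) :
    Integrable (fun z => ‖f z‖ ^ 2) (weightedArea α) :=
  (memLp_two_iff_integrable_sq_norm (Lp.aestronglyMeasurable f)).1 (Lp.memLp f)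

theorem integrable_norm_sq_mul (hφ : MemLp φ ∞ (weightedArea α)) (f : Lp ℂ 2 (weightedArea α)) :
    Integrable (fun z => ‖f z‖ ^ 2 * φ z) (weightedArea α) := by
  obtain ⟨M, -, hM⟩ := ae_abs_le_of_memLp_top hφ
  exact (integrable_norm_sq f).mul_bdd hφ.1 hM

/-- A symbol with a reverse Carleson level set has a coercive quadratic form. -/
theorem exists_coercive_of_isReverseCarleson (hφ : MemLp φ ∞ (weightedArea α))
    (hφ0 : ∀ᵐ z ∂weightedArea α, 0 ≤ φ z) {r : ℝ} (hr : 0 < r)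
    (h : IsReverseCarleson α (levelSet φ r)) :
    ∃ C : ℝ, 0 < C ∧ ∀ f : bergmanSpace α,
      C * ∫ z, ‖(f : Lp ℂ 2 (weightedArea α)) z‖ ^ 2 ∂weightedArea α
        ≤ ∫ z, ‖(f : Lp ℂ 2 (weightedArea α)) z‖ ^ 2 * φ z ∂weightedArea α := by
  obtain ⟨C, hC, h⟩ := h
  refine ⟨r / C, by positivity, fun f => ?_⟩
  have h1 : r * ∫ z in levelSet φ r, ‖(f : Lp ℂ 2 (weightedArea α)) z‖ ^ 2 ∂weightedArea α ≤
      ∫ z, ‖(f : Lp ℂ 2 (weightedArea α)) z‖ ^ 2 * φ z ∂weightedArea α := by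
    rw [← integral_const_mul]
    refine le_trans ?_ (setIntegral_le_integral (s := levelSet φ r) (integrable_norm_sq_mul hφ _)
      (hφ0.mono fun z hz => mul_nonneg (by positivity) hz))
    refine integral_mono_ae ((integrable_norm_sq _).restrict.const_mul r)
      (integrable_norm_sq_mul hφ _).restrict ?_
    filter_upwards [ae_restrict_mem₀ (nullMeasurableSet_levelSet hφ.1 r)] with z hz
    rw [mul_comm]
    exact mul_le_mul_of_nonneg_left hz.2.le (by positivity)
  rw [div_mul_eq_mul_div, div_le_iff₀ hC]
  calc _ ≤ r * (C * ∫ z in levelSet φ r, ‖(f : Lp ℂ 2 (weightedArea α)) z‖ ^ 2 ∂weightedArea α) := by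
        gcongr
        exact h f
    _ ≤ _ := by
        rw [mul_left_comm, mul_comm C]
        gcongr

theorem integrable_norm_kernel_sq (hα : -1 < α) {z : ℂ} (hz : ‖z‖ < 1) :
    Integrable (fun w => ‖kernel α z w‖ ^ 2) (weightedArea α) := by
  have hm := aestronglyMeasurable_of_differentiableOn α (differentiableOn_kernel α hz)
  exact (memLp_two_iff_integrable_sq_norm hm).1
    ((memLp_two_iff_lintegral hm).2 (lintegral_kernel_ne_top hα hz))

theorem integrable_mul_norm_kernel_sq (hα : -1 < α) (hφ : MemLp φ ∞ (weightedArea α)) {z : ℂ}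
    (hz : ‖z‖ < 1) : Integrable (fun w => φ w * ‖kernel α z w‖ ^ 2) (weightedArea α) := by
  obtain ⟨M, -, hM⟩ := ae_abs_le_of_memLp_top hφ
  exact (integrable_norm_kernel_sq hα hz).bdd_mul hφ.1 hM

theorem integral_norm_kernel_sq_pos (hα : -1 < α) {z : ℂ} (hz : ‖z‖ < 1) :
    0 < ∫ w, ‖kernel α z w‖ ^ 2 ∂weightedArea α := by
  obtain ⟨c, hc, h⟩ := exists_le_lintegral_kernel hα
  rw [integral_norm_sq_eq_toReal
    (aestronglyMeasurable_of_differentiableOn α (differentiableOn_kernel α hz))]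
  refine ENNReal.toReal_pos (fun h0 => ?_) (lintegral_kernel_ne_top hα hz)
  have h1 := h z hz
  rw [h0, nonpos_iff_eq_zero, ENNReal.ofReal_eq_zero] at h1
  have : 0 < (1 - ‖z‖) ^ (-(2 + α)) := Real.rpow_pos_of_pos (by linarith) _
  nlinarith

theorem aestronglyMeasurable_berezin (hα : -1 < α) (hφ : AEStronglyMeasurable φ (weightedArea α)) :
    AEStronglyMeasurable (berezin α φ) (weightedArea α) := by
  have := isFiniteMeasure_weightedArea hα
  have hk : Measurable fun p : ℂ × ℂ => ‖kernel α p.1 p.2‖ ^ 2 := (measurable_kernel α).norm.pow_const 2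
  have h1 : StronglyMeasurable fun z => ∫ w, ‖kernel α z w‖ ^ 2 ∂weightedArea α :=
    hk.stronglyMeasurable.integral_prod_right'
  have h2 : StronglyMeasurable fun z => ∫ w, hφ.mk φ w * ‖kernel α z w‖ ^ 2 ∂weightedArea α :=
    ((hφ.stronglyMeasurable_mk.measurable.comp measurable_snd).mul
      hk).stronglyMeasurable.integral_prod_right'
  have e : berezin α φ = fun z => 1 / (∫ w, ‖kernel α z w‖ ^ 2 ∂weightedArea α) *
      ∫ w, hφ.mk φ w * ‖kernel α z w‖ ^ 2 ∂weightedArea α := by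
    ext z
    rw [berezin]
    congr 1
    refine integral_congr_ae ?_
    filter_upwards [hφ.ae_eq_mk] with w hw
    rw [hw]
  rw [e]
  exact ((measurable_const.div h1.measurable).mul h2.measurable).aestronglyMeasurable

/-- If the quadratic form of `φ` is coercive, then its values at the normalized reproducing kernels,
which make up the Berezin transform, are bounded below. -/
theorem isInvertibleLInfty_berezin_of_coercive (hα : -1 < α) (hφ : MemLp φ ∞ (weightedArea α))
    {C : ℝ} (hC : 0 < C) (h : ∀ f : bergmanSpace α,
      C * ∫ z, ‖(f : Lp ℂ 2 (weightedArea α)) z‖ ^ 2 ∂weightedArea α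
        ≤ ∫ z, ‖(f : Lp ℂ 2 (weightedArea α)) z‖ ^ 2 * φ z ∂weightedArea α) :
    IsInvertibleLInfty α (berezin α φ) := by
  obtain ⟨M, hM0, hM⟩ := ae_abs_le_of_memLp_top hφ
  have hmeas := aestronglyMeasurable_berezin hα hφ.1
  have hlow : ∀ z : ℂ, ‖z‖ < 1 → C ≤ berezin α φ z := by
    intro z hz
    have hN := integral_norm_kernel_sq_pos hα hz
    obtain ⟨f, hf⟩ := exists_bergmanSpace_eq (differentiableOn_kernel α hz)
      (lintegral_kernel_ne_top hα hz)
    have h1 := h f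
    have e1 : ∫ w, ‖(f : Lp ℂ 2 (weightedArea α)) w‖ ^ 2 ∂weightedArea α =
        ∫ w, ‖kernel α z w‖ ^ 2 ∂weightedArea α :=
      integral_congr_ae (hf.mono fun w hw => by simp only [hw])
    have e2 : ∫ w, ‖(f : Lp ℂ 2 (weightedArea α)) w‖ ^ 2 * φ w ∂weightedArea α =
        ∫ w, φ w * ‖kernel α z w‖ ^ 2 ∂weightedArea α :=
      integral_congr_ae (hf.mono fun w hw => by simp only [hw, mul_comm])
    rw [e1, e2] at h1
    rw [berezin, one_div_mul_eq_div, le_div_iff₀ hN]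
    exact h1
  have hup : ∀ z : ℂ, ‖z‖ < 1 → berezin α φ z ≤ M := by
    intro z hz
    have hN := integral_norm_kernel_sq_pos hα hz
    rw [berezin, one_div_mul_eq_div, div_le_iff₀ hN, ← integral_const_mul]
    refine integral_mono_ae (integrable_mul_norm_kernel_sq hα hφ hz)
      ((integrable_norm_kernel_sq hα hz).const_mul M) ?_
    filter_upwards [hM] with w hw
    exact mul_le_mul_of_nonneg_right ((le_abs_self _).trans hw) (by positivity)
  refine ⟨memLp_top_of_bound hmeas M ?_, fun z => (berezin α φ z)⁻¹,
    memLp_top_of_bound hmeas.aemeasurable.inv.aestronglyMeasurable C⁻¹ ?_, ?_⟩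
  · filter_upwards [ae_norm_lt_one α] with z hz
    rw [Real.norm_eq_abs, abs_of_pos (hC.trans_le (hlow z hz))]
    exact hup z hz
  · filter_upwards [ae_norm_lt_one α] with z hz
    have h1 := hlow z hz
    rw [Real.norm_eq_abs, abs_of_pos (inv_pos.2 (hC.trans_le h1))]
    exact inv_anti₀ hC h1
  · filter_upwards [ae_norm_lt_one α] with z hz
    exact mul_inv_cancel₀ (hC.trans_le (hlow z hz)).ne'

/-- If the Berezin transform of `φ` is bounded below, then the part of `φ` below a small level
contributes little to it, so that a level set carries part of the mass of every kernel. -/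
theorem exists_isBoundaryDense_of_isInvertibleLInfty (hα : -1 < α)
    (hφ : MemLp φ ∞ (weightedArea α)) (hφ0 : ∀ᵐ z ∂weightedArea α, 0 ≤ φ z)
    (h : IsInvertibleLInfty α (berezin α φ)) :
    ∃ r : ℝ, 0 < r ∧ IsBoundaryDense (levelSet φ r) := by
  obtain ⟨-, g, hg, hfg⟩ := h
  obtain ⟨B, hB0, hB⟩ := ae_abs_le_of_memLp_top hg
  obtain ⟨M, hM0, hM⟩ := ae_abs_le_of_memLp_top hφ
  refine ⟨1 / (2 * B), by positivity, ?_⟩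
  -- half of the lower bound `1 / B` of the Berezin transform
  set r : ℝ := 1 / (2 * B) with hr
  have hr0 : 0 < r := by positivity
  have hGm := nullMeasurableSet_levelSet hφ.1 r
  refine isBoundaryDense_of_kernel hα hGm (c := r / M) (by positivity) ?_
  filter_upwards [hfg, hB, ae_norm_lt_one α] with z h1 h2 hz
  have hN := integral_norm_kernel_sq_pos hα hz
  have hK := integrable_norm_kernel_sq hα hz
  have hφK := integrable_mul_norm_kernel_sq hα hφ hz
  have hkm := aestronglyMeasurable_of_differentiableOn α (differentiableOn_kernel α hz)
  have hfin := lintegral_kernel_ne_top hα hz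
  have hnum : 0 ≤ ∫ w, φ w * ‖kernel α z w‖ ^ 2 ∂weightedArea α :=
    integral_nonneg_of_ae (hφ0.mono fun w hw => mul_nonneg hw (by positivity))
  have hb0 : 0 ≤ berezin α φ z := mul_nonneg (by positivity) hnum
  have hlow : 2 * r ≤ berezin α φ z := by
    have h3 : 1 ≤ berezin α φ z * B := by
      rw [← h1]
      exact mul_le_mul_of_nonneg_left ((le_abs_self _).trans h2) hb0
    have : 2 * r = 1 / B := by rw [hr]; field_simp
    rw [this, div_le_iff₀ hB0]
    exact h3
  rw [berezin, one_div_mul_eq_div, le_div_iff₀ hN] at hlow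
  have hsplit : ∫ w, φ w * ‖kernel α z w‖ ^ 2 ∂weightedArea α ≤
      M * (∫ w in levelSet φ r, ‖kernel α z w‖ ^ 2 ∂weightedArea α) +
        r * ∫ w, ‖kernel α z w‖ ^ 2 ∂weightedArea α := by
    rw [← integral_indicator₀ hGm, ← integral_const_mul, ← integral_const_mul,
      ← integral_add ((hK.indicator₀ hGm).const_mul M) (hK.const_mul r)]
    refine integral_mono_ae hφK (((hK.indicator₀ hGm).const_mul M).add (hK.const_mul r)) ?_
    filter_upwards [hM, ae_norm_lt_one α] with w hw hw1
    have hk0 : 0 ≤ ‖kernel α z w‖ ^ 2 := by positivity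
    by_cases hwG : w ∈ levelSet φ r
    · rw [Set.indicator_of_mem hwG]
      have := mul_le_mul_of_nonneg_right ((le_abs_self _).trans hw) hk0
      nlinarith
    · rw [Set.indicator_of_notMem hwG, mul_zero, zero_add]
      have h5 : φ w ≤ r := by
        by_contra h6
        exact hwG ⟨mem_ball_zero_iff.2 hw1, not_le.1 h6⟩
      exact mul_le_mul_of_nonneg_right h5 hk0
  have hreal : r * ∫ w, ‖kernel α z w‖ ^ 2 ∂weightedArea α ≤
      M * ∫ w in levelSet φ r, ‖kernel α z w‖ ^ 2 ∂weightedArea α := by linarith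
  rw [integral_norm_sq_eq_toReal hkm, integral_norm_sq_eq_toReal hkm.restrict] at hreal
  have hfinG : ∫⁻ w in levelSet φ r, ‖kernel α z w‖ₑ ^ 2 ∂weightedArea α ≠ ∞ :=
    ne_top_of_le_ne_top hfin (setLIntegral_le_lintegral _ _)
  rw [← ENNReal.toReal_le_toReal (by finiteness) hfinG, ENNReal.toReal_mul,
    ENNReal.toReal_ofReal (by positivity), div_mul_eq_mul_div, div_le_iff₀ hM0]
  linarith

theorem norm_sq_eq_integral (f : Lp ℂ 2 (weightedArea α)) :
    ‖f‖ ^ 2 = ∫ z, ‖f z‖ ^ 2 ∂weightedArea α := by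
  have h1 := inner_self_eq_norm_sq_to_K (𝕜 := ℂ) f
  rw [L2.inner_def] at h1
  have h2 : ∫ z, inner ℂ (f z) (f z) ∂weightedArea α =
      ((∫ z, ‖f z‖ ^ 2 ∂weightedArea α : ℝ) : ℂ) := by
    rw [← integral_complex_ofReal]
    refine integral_congr_ae (Eventually.of_forall fun z => ?_)
    simp only [inner_self_eq_norm_sq_to_K]
    push_cast
    rfl
  rw [h2] at h1
  have h3 : (((∫ z, ‖f z‖ ^ 2 ∂weightedArea α : ℝ)) : ℂ) = ((‖f‖ ^ 2 : ℝ) : ℂ) := by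
    rw [h1]; push_cast; rfl
  exact (Complex.ofReal_injective h3).symm

/-- Multiplication by `φ` on `L²(ω_α)`, which enters the definition of the Toeplitz operator. -/
theorem coeFn_mul_symbol (hφ : MemLp φ ∞ (weightedArea α)) (f : Lp ℂ 2 (weightedArea α)) :
    ((ContinuousLinearMap.mul ℂ ℂ).holderL (weightedArea α) ∞ 2 2
      (hφ.ofReal.toLp (fun z => (φ z : ℂ))) f : Lp ℂ 2 (weightedArea α))
      =ᵐ[weightedArea α] fun z => (φ z : ℂ) * f z := by
  rw [ContinuousLinearMap.holderL_apply_apply]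
  filter_upwards [ContinuousLinearMap.coeFn_holder (r := 2) (ContinuousLinearMap.mul ℂ ℂ)
    (hφ.ofReal.toLp (fun z => (φ z : ℂ))) f, (MemLp.ofReal (K := ℂ) hφ).coeFn_toLp] with z h1 h2
  rw [h1, ContinuousLinearMap.mul_apply']
  exact congrArg (· * f z) h2

theorem inner_toeplitz (hφ : MemLp φ ∞ (weightedArea α)) (f : bergmanSpace α) :
    inner ℂ (toeplitz α (hφ.ofReal.toLp (fun z => (φ z : ℂ))) f) f =
      ((∫ z, ‖(f : Lp ℂ 2 (weightedArea α)) z‖ ^ 2 * φ z ∂weightedArea α : ℝ) : ℂ) := by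
  rw [toeplitz, ContinuousLinearMap.comp_apply, ContinuousLinearMap.comp_apply,
    Submodule.inner_orthogonalProjectionOnto_eq_of_mem_right, L2.inner_def,
    ← integral_complex_ofReal]
  refine integral_congr_ae ?_
  filter_upwards [coeFn_mul_symbol hφ (f : Lp ℂ 2 (weightedArea α))] with z hz
  rw [Submodule.subtypeL_apply, hz, RCLike.inner_apply, map_mul, Complex.conj_ofReal, mul_left_comm,
    Complex.mul_conj, Complex.normSq_eq_norm_sq]
  simp [mul_comm]

/-- This holds because `φ² ≤ M φ`; it makes an invertible Toeplitz operator coercive. -/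
theorem norm_toeplitz_sq_le (hφ : MemLp φ ∞ (weightedArea α))
    (hφ0 : ∀ᵐ z ∂weightedArea α, 0 ≤ φ z) {M : ℝ} (hM : ∀ᵐ z ∂weightedArea α, |φ z| ≤ M)
    (f : bergmanSpace α) :
    ‖toeplitz α (hφ.ofReal.toLp (fun z => (φ z : ℂ))) f‖ ^ 2 ≤
      M * ∫ z, ‖(f : Lp ℂ 2 (weightedArea α)) z‖ ^ 2 * φ z ∂weightedArea α := by
  rw [toeplitz, ContinuousLinearMap.comp_apply, ContinuousLinearMap.comp_apply,
    Submodule.subtypeL_apply]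
  refine (pow_le_pow_left₀ (norm_nonneg _)
    ((bergmanSpace α).norm_orthogonalProjectionOnto_apply_le _) 2).trans ?_
  rw [norm_sq_eq_integral, ← integral_const_mul]
  refine integral_mono_ae (integrable_norm_sq _) ((integrable_norm_sq_mul hφ _).const_mul M) ?_
  filter_upwards [coeFn_mul_symbol hφ (f : Lp ℂ 2 (weightedArea α)), hφ0, hM] with z h1 h2 h3
  rw [abs_of_nonneg h2] at h3
  rw [h1, norm_mul, Complex.norm_real, Real.norm_eq_abs, abs_of_nonneg h2, mul_pow]
  have h4 : 0 ≤ ‖(f : Lp ℂ 2 (weightedArea α)) z‖ ^ 2 * φ z := by positivity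
  nlinarith

/-- A Toeplitz operator with nonnegative symbol is invertible if and only if its quadratic form is
coercive. -/
theorem isUnit_toeplitz_iff (hφ : MemLp φ ∞ (weightedArea α))
    (hφ0 : ∀ᵐ z ∂weightedArea α, 0 ≤ φ z) :
    IsUnit (toeplitz α (hφ.ofReal.toLp (fun z => (φ z : ℂ)))) ↔
      ∃ C : ℝ, 0 < C ∧ ∀ f : bergmanSpace α,
        C * ∫ z, ‖(f : Lp ℂ 2 (weightedArea α)) z‖ ^ 2 ∂weightedArea α
          ≤ ∫ z, ‖(f : Lp ℂ 2 (weightedArea α)) z‖ ^ 2 * φ z ∂weightedArea α := by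
  set T := toeplitz α (hφ.ofReal.toLp (fun z => (φ z : ℂ))) with hT
  constructor
  · rintro ⟨u, hu⟩
    obtain ⟨M, hM0, hM⟩ := ae_abs_le_of_memLp_top hφ
    set S : bergmanSpace α →L[ℂ] bergmanSpace α := ↑u⁻¹ with hS
    have hST : ∀ f, S (T f) = f := fun f => by
      rw [← mul_apply_eq_comp, hS, ← hu, Units.inv_mul, one_apply_eq_self]
    refine ⟨1 / (‖S‖ ^ 2 * M + 1), by positivity, fun f => ?_⟩
    have hQ : 0 ≤ ∫ z, ‖(f : Lp ℂ 2 (weightedArea α)) z‖ ^ 2 * φ z ∂weightedArea α :=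
      integral_nonneg_of_ae (hφ0.mono fun z hz => mul_nonneg (by positivity) hz)
    have h1 := norm_toeplitz_sq_le hφ hφ0 hM f
    have h2 : ‖f‖ ≤ ‖S‖ * ‖T f‖ := by
      calc ‖f‖ = ‖S (T f)‖ := by rw [hST]
        _ ≤ _ := S.le_opNorm _
    rw [one_div_mul_eq_div, div_le_iff₀ (by positivity), ← norm_sq_eq_integral]
    calc ‖(f : Lp ℂ 2 (weightedArea α))‖ ^ 2 ≤ (‖S‖ * ‖T f‖) ^ 2 :=
          pow_le_pow_left₀ (norm_nonneg _) h2 2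
      _ = ‖S‖ ^ 2 * ‖T f‖ ^ 2 := by ring
      _ ≤ ‖S‖ ^ 2 * (M * ∫ z, ‖(f : Lp ℂ 2 (weightedArea α)) z‖ ^ 2 * φ z ∂weightedArea α) := by
          gcongr
      _ ≤ _ := by linarith
  · rintro ⟨C, hC, h⟩
    refine ContinuousLinearMap.isUnit_of_forall_le_norm_inner_map T (c := ⟨C, hC.le⟩) hC fun f => ?_
    have h1 := h f
    rw [inner_toeplitz hφ f, Complex.norm_real, Real.norm_eq_abs]
    rw [← norm_sq_eq_integral] at h1
    refine le_trans (le_of_eq ?_) (h1.trans (le_abs_self _))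
    rw [mul_comm]
    rfl

end Symbol

end DiskBergman

theorem mainTheorem10 (α : ℝ) (hα : -1 < α) (φ : ℂ → ℝ)
    (hφ : MeasureTheory.MemLp φ ∞ (DiskBergman.weightedArea α))
    (hφ0 : ∀ᵐ z ∂DiskBergman.weightedArea α, 0 ≤ φ z) :
    [IsUnit (DiskBergman.toeplitz α
        (hφ.ofReal.toLp (fun z => (φ z : ℂ)))),
      DiskBergman.IsInvertibleLInfty α (DiskBergman.berezin α φ),
      ∃ r : ℝ, 0 < r ∧ DiskBergman.IsReverseCarleson α (DiskBergman.levelSet φ r),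
      ∃ r : ℝ, 0 < r ∧ DiskBergman.IsBoundaryDense (DiskBergman.levelSet φ r),
      ∃ C : ℝ, 0 < C ∧ ∀ f : DiskBergman.bergmanSpace α,
        C * ∫ z, ‖(f : MeasureTheory.Lp ℂ 2 (DiskBergman.weightedArea α)) z‖ ^ 2
            ∂DiskBergman.weightedArea α
          ≤ ∫ z, ‖(f : MeasureTheory.Lp ℂ 2 (DiskBergman.weightedArea α)) z‖ ^ 2 * φ z
            ∂DiskBergman.weightedArea α].TFAE ∧
    ∀ r : ℝ, 0 < r →
      (DiskBergman.IsReverseCarleson α (DiskBergman.levelSet φ r) ↔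
        DiskBergman.IsBoundaryDense (DiskBergman.levelSet φ r)) := by
  have hiff : ∀ r : ℝ, DiskBergman.IsReverseCarleson α (DiskBergman.levelSet φ r) ↔
      DiskBergman.IsBoundaryDense (DiskBergman.levelSet φ r) := fun r =>
    DiskBergman.isReverseCarleson_iff_isBoundaryDense hα
      (DiskBergman.nullMeasurableSet_levelSet hφ.1 r)
  refine ⟨?_, fun r _ => hiff r⟩
  tfae_have 1 ↔ 5 := DiskBergman.isUnit_toeplitz_iff hφ hφ0
  tfae_have 5 → 2 := fun ⟨C, hC, h⟩ =>
    DiskBergman.isInvertibleLInfty_berezin_of_coercive hα hφ hC h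
  tfae_have 2 → 4 := DiskBergman.exists_isBoundaryDense_of_isInvertibleLInfty hα hφ hφ0
  tfae_have 4 → 3 := fun ⟨r, hr, h⟩ => ⟨r, hr, (hiff r).2 h⟩
  tfae_have 3 → 5 := fun ⟨r, hr, h⟩ =>
    DiskBergman.exists_coercive_of_isReverseCarleson hφ hφ0 hr h
  tfae_finish
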